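/- Let $K$ be an algebraically closed field and let $s\ge 3$ be an integer. Let $\Gamma_s$ be the quiver with vertices $i\in\mathbb Z/s$ (represented by $0,\dots,s-1$) and two arrows $a_i,b_i\colon i\to i+1$ for each $i$. Paths are composed from left to right, $e_i$ is the trivial path at $i$, and $x=\sum_i a_i$, $y=\sum_i b_i$ in the path algebra $K\Gamma_s$. Put $\Lambda_s=K\Gamma_s/\langle x^2,\,xy+yx,\,y^2\rangle$, let $\Lambda_s^e$ be its enveloping algebra, and let $\mathrm{HH}^n(\Lambda_s)=\mathrm{Ext}^n_{\Lambda_s^e}(\Lambda_s,\Lambda_s)$. For $n\ge 0$ let $Q^n=\bigoplus_{i\in\mathbb Z/s}\bigoplus_{j=0}^{n}\Lambda_s e_i\otimes_K e_{i+n}\Lambda_s$, and let $b^n_{i,j}$ be the generator $e_i\otimes e_{i+n}$ of the summand with index $(i,j)$; put $b^n_{i,j}=0$ if $j<0$ or $j>n$. Let $\partial^0\colon Q^0\to\Lambda_s$ be the multiplication map, and for $n\ge1$ let $\partial^n\colon Q^n\to Q^{n-1}$ be the bimodule homomorphism with $$\partial^n(b^n_{i,j})=b^{n-1}_{i,j-1}x+b^{n-1}_{i,j}y+(-1)^n\bigl(y\,b^{n-1}_{i+1,j}+x\,b^{n-1}_{i+1,j-1}\bigr)\qquad(0\le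 j\le n).$$ For $i\in\mathbb Z/s$ and $0\le j\le n$ let $\alpha^n_{i,j}$ (if $n\equiv0 \bmod s$), $\beta^n_{i,j}$ and $\gamma^n_{i,j}$ (if $n\equiv1\bmod s$), $\delta^n_{i,j}$ (if $n\equiv2\bmod s$) be the bimodule homomorphisms $Q^n\to\Lambda_s$ that send $b^n_{i,j}$ to $e_i$, $e_ix$, $e_iy$, $e_ixy$, respectively, and all other generators $b^n_{k,l}$ to $0$. Then $(Q^\bullet,\partial^\bullet)$ is a projective resolution of the bimodule $\Lambda_s$. Identify $\mathrm{HH}^n(\Lambda_s)$ with the $n$-th cohomology of $\mathrm{Hom}_{\Lambda_s^e}(Q^\bullet,\Lambda_s)$ through it. For all integers $m\ge0$ the following hold. 1. If $s$ is odd, $m$ is odd and $\operatorname{char}K\ne2$, then $\mathrm{HH}^{ms}(\Lambda_s)=\mathrm{HH}^{ms+1}(\Lambda_s)=\mathrm{HH}^{ms+2}(\Lambda_s)=0$. 2. If $s$ is even, or $m$ is even, or $\operatorname{char}K=2$, then the maps listed below are cocycles, and their classes form - a $K$-basis of $\mathrm{HH}^{ms}(\Lambda_s)$: $\ \sum_{i=0}^{s-1}\alpha^{ms}_{i,j}$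 $(0\le j\le ms)$; - a $K$-basis of $\mathrm{HH}^{ms+1}(\Lambda_s)$: $\ \sum_{i=0}^{s-1}\beta^{ms+1}_{i,0}$, $\ \sum_{i=0}^{s-1}\gamma^{ms+1}_{i,j}$ $(0\le j\le ms+1)$, and $\beta^{ms+1}_{s-1,j+1}+\gamma^{ms+1}_{s-1,j}$ $(0\le j\le ms)$; - a $K$-basis of $\mathrm{HH}^{ms+2}(\Lambda_s)$: $\ \delta^{ms+2}_{s-1,j}$ $(0\le j\le ms+2)$. 3. $\mathrm{HH}^{ms+r}(\Lambda_s)=0$ for $0\le r\le s-1$ with $r\notin\{0,1,2\}$. -/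

import Mathlib

open CategoryTheory TensorProduct MulOpposite

open scoped DirectSum

universe u

noncomputable section

/-! ### The path algebra of a quiver with finitely many vertices -/

/-- The underlying vector space of the path algebra `K V` of a quiver `V`: formal linear
combinations of the oriented paths of `V`, the trivial paths included. -/
def PathAlgebra (K : Type u) (V : Type) [Quiver.{0} V] [Field K] : Type u :=
  (Σ i j : V, Quiver.Path i j) →₀ K

namespace PathAlgebra

variable (K : Type u) (V : Type) [Quiver.{0} V] [Field K]

instance : AddCommGroup (PathAlgebra K V) :=
  inferInstanceAs (AddCommGroup ((Σ i j : V, Quiver.Path i j) →₀ K))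

instance : Module K (PathAlgebra K V) :=
  inferInstanceAs (Module K ((Σ i j : V, Quiver.Path i j) →₀ K))

variable {V}

/-- The basis element of the path algebra given by a path. -/
def ofPath {i j : V} (p : Quiver.Path i j) : PathAlgebra K V :=
  Finsupp.single ⟨i, j, p⟩ 1

open Classical in
/-- The product of two paths, written from left to right: `p q` is "first `p`, then `q`" if `p`
ends where `q` starts, and `0` otherwise. -/
def pathMul (p q : Σ i j : V, Quiver.Path i j) : PathAlgebra K V :=
  if h : q.1 = p.2.1 then ofPath K (p.2.2.comp (q.2.2.cast h rfl)) else 0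

variable (V)

/-- The bilinear extension of the product of paths. -/
def mulHom : PathAlgebra K V →ₗ[K] PathAlgebra K V →ₗ[K] PathAlgebra K V :=
  Finsupp.lift (PathAlgebra K V →ₗ[K] PathAlgebra K V) K (Σ i j : V, Quiver.Path i j) fun p =>
    Finsupp.lift (PathAlgebra K V) K (Σ i j : V, Quiver.Path i j) fun q => pathMul K p q

instance : Mul (PathAlgebra K V) := ⟨fun f g => mulHom K V f g⟩

instance [Fintype V] : One (PathAlgebra K V) :=
  ⟨∑ v : V, ofPath K (Quiver.Path.nil : Quiver.Path v v)⟩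

variable {V}

theorem mul_def (f g : PathAlgebra K V) : f * g = mulHom K V f g := rfl

theorem mulHom_ofPath {i j k l : V} (p : Quiver.Path i j) (q : Quiver.Path k l) :
    mulHom K V (ofPath K p) (ofPath K q) = pathMul K ⟨i, j, p⟩ ⟨k, l, q⟩ := by
  have h1 : mulHom K V (ofPath K p) =
      Finsupp.lift (PathAlgebra K V) K (Σ i j : V, Quiver.Path i j)
        fun q => pathMul K ⟨i, j, p⟩ q := by
    refine (Finsupp.sum_single_index ?_).trans ?_
    · exact zero_smul K _
    · exact one_smul K _
  rw [h1]
  refine (Finsupp.sum_single_index ?_).trans ?_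
  · exact zero_smul K _
  · exact one_smul K _

theorem ofPath_mul {i j l : V} (p : Quiver.Path i j) (q : Quiver.Path j l) :
    ofPath K p * ofPath K q = ofPath K (p.comp q) := by
  rw [mul_def, mulHom_ofPath, pathMul, dif_pos rfl]
  rfl

theorem ofPath_mul_ne {i j k l : V} (p : Quiver.Path i j) (q : Quiver.Path k l) (h : k ≠ j) :
    ofPath K p * ofPath K q = 0 := by
  rw [mul_def, mulHom_ofPath, pathMul, dif_neg h]

theorem span_induction {P : PathAlgebra K V → Prop} (f : PathAlgebra K V) (zero : P 0)
    (add : ∀ f g, P f → P g → P (f + g))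
    (smul_ofPath : ∀ (c : K) (i j : V) (p : Quiver.Path i j), P (c • ofPath K p)) : P f := by
  refine Finsupp.induction_linear f zero (fun f g hf hg => add f g hf hg) ?_
  rintro ⟨i, j, p⟩ c
  have h : (c • ofPath K p : PathAlgebra K V) =
      (Finsupp.single ⟨i, j, p⟩ c : (Σ i j : V, Quiver.Path i j) →₀ K) :=
    (Finsupp.smul_single _ _ _).trans (by rw [smul_eq_mul, mul_one])
  exact h ▸ smul_ofPath c i j p

theorem ofPath_assoc {i j k l m n : V} (p : Quiver.Path i j) (q : Quiver.Path k l)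
    (r : Quiver.Path m n) :
    ofPath K p * ofPath K q * ofPath K r = ofPath K p * (ofPath K q * ofPath K r) := by
  have z1 : ∀ f : PathAlgebra K V, 0 * f = 0 := fun f => by
    rw [mul_def, map_zero, LinearMap.zero_apply]
  have z2 : ∀ f : PathAlgebra K V, f * 0 = 0 := fun f => by rw [mul_def, map_zero]
  by_cases h : k = j
  · subst h
    by_cases h' : m = l
    · subst h'
      simp only [ofPath_mul, Quiver.Path.comp_assoc]
    · rw [ofPath_mul, ofPath_mul_ne K _ _ h', ofPath_mul_ne K _ _ h', z2]
  · rw [ofPath_mul_ne K _ _ h, z1]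
    by_cases h' : m = l
    · subst h'
      rw [ofPath_mul, ofPath_mul_ne K _ _ h]
    · rw [ofPath_mul_ne K _ _ h', z2]

instance : NonUnitalNonAssocRing (PathAlgebra K V) where
  left_distrib f g h := by simp only [mul_def, map_add]
  right_distrib f g h := by simp only [mul_def, map_add, LinearMap.add_apply]
  zero_mul f := by rw [mul_def, map_zero, LinearMap.zero_apply]
  mul_zero f := by rw [mul_def, map_zero]

instance : IsScalarTower K (PathAlgebra K V) (PathAlgebra K V) where
  smul_assoc c f g := by simp only [smul_eq_mul, mul_def, map_smul, LinearMap.smul_apply]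

instance : SMulCommClass K (PathAlgebra K V) (PathAlgebra K V) where
  smul_comm c f g := by simp only [smul_eq_mul, mul_def, map_smul]

theorem ofPath_nil_mul_ofPath [DecidableEq V] (v : V) {i j : V} (p : Quiver.Path i j) :
    ofPath K (Quiver.Path.nil : Quiver.Path v v) * ofPath K p =
      if i = v then ofPath K p else 0 := by
  split_ifs with h
  · subst h
    rw [ofPath_mul, Quiver.Path.nil_comp]
  · exact ofPath_mul_ne K _ _ h

theorem ofPath_mul_ofPath_nil [DecidableEq V] (v : V) {i j : V} (p : Quiver.Path i j) :
    ofPath K p * ofPath K (Quiver.Path.nil : Quiver.Path v v) =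
      if v = j then ofPath K p else 0 := by
  split_ifs with h
  · subst h
    rw [ofPath_mul, Quiver.Path.comp_nil]
  · exact ofPath_mul_ne K _ _ h

/-- The ring structure of the path algebra: the product concatenates paths, and the unit is the
sum of the trivial paths. -/
instance [Fintype V] : Ring (PathAlgebra K V) where
  __ := (inferInstance : NonUnitalNonAssocRing (PathAlgebra K V))
  __ := (inferInstance : One (PathAlgebra K V))
  mul_assoc f g h := by
    induction f using span_induction with
    | zero => simp only [zero_mul]
    | add f f' hf hf' => simp only [add_mul, hf, hf']
    | smul_ofPath c i j p =>
      induction g using span_induction with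
      | zero => simp only [zero_mul, mul_zero]
      | add g g' hg hg' => simp only [add_mul, mul_add, hg, hg']
      | smul_ofPath c' i' j' p' =>
        induction h using span_induction with
        | zero => simp only [mul_zero]
        | add h h' hh hh' => simp only [mul_add, hh, hh']
        | smul_ofPath c'' i'' j'' p'' =>
          simp only [smul_mul_assoc, mul_smul_comm, ofPath_assoc]
  one_mul f := by
    classical
    change (∑ v : V, ofPath K (Quiver.Path.nil : Quiver.Path v v)) * f = f
    induction f using span_induction with
    | zero => rw [mul_zero]
    | add f g hf hg => rw [mul_add, hf, hg]
    | smul_ofPath c i j p =>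
      simp only [mul_smul_comm, Finset.sum_mul, ofPath_nil_mul_ofPath, Finset.sum_ite_eq,
        Finset.mem_univ, if_true]
  mul_one f := by
    classical
    change f * (∑ v : V, ofPath K (Quiver.Path.nil : Quiver.Path v v)) = f
    induction f using span_induction with
    | zero => rw [zero_mul]
    | add f g hf hg => rw [add_mul, hf, hg]
    | smul_ofPath c i j p =>
      simp only [smul_mul_assoc, Finset.mul_sum, ofPath_mul_ofPath_nil, ← Finset.smul_sum,
        Finset.sum_ite_eq', Finset.mem_univ, if_true]

instance [Fintype V] : Algebra K (PathAlgebra K V) :=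
  Algebra.ofModule (fun c f g => smul_mul_assoc c f g) (fun c f g => mul_smul_comm c f g)

end PathAlgebra

/-! ### Hochschild cohomology of an algebra over a field -/

section Hochschild

variable (K A : Type u) [Field K] [Ring A] [Algebra K A]

/-- The enveloping algebra `A ⊗ Aᵒᵖ`. Its left modules are the `A`-`A`-bimodules on which `K` acts
centrally. -/
def EnvAlg : Type u := A ⊗[K] Aᵐᵒᵖ

instance : Ring (EnvAlg K A) := inferInstanceAs (Ring (A ⊗[K] Aᵐᵒᵖ))

instance : Algebra K (EnvAlg K A) := inferInstanceAs (Algebra K (A ⊗[K] Aᵐᵒᵖ))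

variable {A} in
/-- The element `a ⊗ c` of the enveloping algebra; on a bimodule it acts by `z ↦ a z c`. -/
def EnvAlg.mk (a c : A) : EnvAlg K A := a ⊗ₜ[K] op c

theorem EnvAlg.mk_mul_mk (a c a' c' : A) :
    EnvAlg.mk K a c * EnvAlg.mk K a' c' = EnvAlg.mk K (a * a') (c' * c) :=
  Algebra.TensorProduct.tmul_mul_tmul a a' (op c) (op c')

theorem EnvAlg.add_mk (a a' c : A) :
    EnvAlg.mk K (a + a') c = EnvAlg.mk K a c + EnvAlg.mk K a' c :=
  TensorProduct.add_tmul a a' (op c)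

theorem EnvAlg.mk_add (a c c' : A) :
    EnvAlg.mk K a (c + c') = EnvAlg.mk K a c + EnvAlg.mk K a c' :=
  TensorProduct.tmul_add a (op c) (op c')

theorem EnvAlg.zero_mk (c : A) : EnvAlg.mk K 0 c = 0 :=
  TensorProduct.zero_tmul A (op c)

theorem EnvAlg.mk_zero (a : A) : EnvAlg.mk K a 0 = 0 :=
  TensorProduct.tmul_zero Aᵐᵒᵖ a

/-- The algebra `A` as a bimodule over itself: `a ⊗ c` acts by `z ↦ a z c`. -/
instance : Module (EnvAlg K A) A := instModuleTensorProductMop K A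

theorem EnvAlg.mk_smul (a c z : A) : EnvAlg.mk K a c • z = a * z * c := by
  change a • (op c • z) = _
  rw [smul_eq_mul, op_smul_eq_mul, mul_assoc]

/-- The algebra `A` as an object of the category of its bimodules. -/
abbrev regularBimodule : ModuleCat.{u} (EnvAlg K A) := ModuleCat.of (EnvAlg K A) A

/-- The Hochschild cohomology `HHⁿ(A) = Extⁿ(A, A)`, where `Ext` is taken over the enveloping
algebra of `A`. It is a vector space over `K`. -/
abbrev HH (n : ℕ) : Type u :=
  Abelian.Ext.{u} (regularBimodule K A) (regularBimodule K A) n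

end Hochschild

/-- For a projective resolution `R` of `X`, this says that every member of the family `f` of maps
from the `n`-th term of `R` to `Y` is a cocycle and that the classes of these cocycles
form a `K`-basis of `Extⁿ(X, Y)`. -/
def ClassesFormBasis (K : Type u) [Field K] {E : Type u} [Ring E] [Algebra K E]
    {X Y : ModuleCat.{u} E} (R : ProjectiveResolution X) (n : ℕ) {ι : Type}
    (f : ι → (R.complex.X n ⟶ Y)) : Prop :=
  ∃ B : Module.Basis ι K (Abelian.Ext.{u} X Y n), ∀ t : ι,
    ∃ hf : R.complex.d (n + 1) n ≫ f t = 0, B t = R.extMk (f t) (n + 1) rfl hf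

/-! ### The circular quiver with double arrows and the algebra -/

/-- The arrows of the circular quiver with double arrows: its vertices are the residues modulo `s`,
and for every vertex `i` there are two arrows `a i` and `b i` from `i` to `i + 1`. -/
inductive CircArrow (s : ℕ) : ZMod s → ZMod s → Type
  | a (i : ZMod s) : CircArrow s i (i + 1)
  | b (i : ZMod s) : CircArrow s i (i + 1)

instance circularQuiver (s : ℕ) : Quiver.{0} (ZMod s) := ⟨CircArrow s⟩

/-- The arrow `a i`, as an arrow of the quiver. -/
def arrowA (s : ℕ) (i : ZMod s) : i ⟶ i + 1 := CircArrow.a i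

/-- The arrow `b i`, as an arrow of the quiver. -/
def arrowB (s : ℕ) (i : ZMod s) : i ⟶ i + 1 := CircArrow.b i

namespace CircAlg

variable (K : Type u) [Field K] (s : ℕ) [NeZero s]

/-- The trivial path at the vertex `i`. -/
def pathE (i : ZMod s) : PathAlgebra K (ZMod s) :=
  PathAlgebra.ofPath K (Quiver.Path.nil : Quiver.Path i i)

/-- The sum of all arrows `a i`. -/
def pathX : PathAlgebra K (ZMod s) := ∑ i, PathAlgebra.ofPath K (arrowA s i).toPath

/-- The sum of all arrows `b i`. -/
def pathY : PathAlgebra K (ZMod s) := ∑ i, PathAlgebra.ofPath K (arrowB s i).toPath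

/-- The two-sided ideal generated by `x²`, `xy + yx` and `y²`. -/
def relIdeal : TwoSidedIdeal (PathAlgebra K (ZMod s)) :=
  TwoSidedIdeal.span {pathX K s * pathX K s, pathX K s * pathY K s + pathY K s * pathX K s,
    pathY K s * pathY K s}

/-- The bound quiver algebra: the quotient of the path algebra of the circular quiver by the ideal
generated by `x²`, `xy + yx` and `y²`. -/
def Lam : Type u := (relIdeal K s).ringCon.Quotient

instance : Ring (Lam K s) := inferInstanceAs (Ring (relIdeal K s).ringCon.Quotient)

instance : Algebra K (Lam K s) := inferInstanceAs (Algebra K (relIdeal K s).ringCon.Quotient)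

/-- The projection from the path algebra. -/
def toLam : PathAlgebra K (ZMod s) →ₐ[K] Lam K s := (relIdeal K s).ringCon.mkₐ K

/-- The class of the trivial path at `i`. -/
def e (i : ZMod s) : Lam K s := toLam K s (pathE K s i)

/-- The class of `x`. -/
def x : Lam K s := toLam K s (pathX K s)

/-- The class of `y`. -/
def y : Lam K s := toLam K s (pathY K s)

theorem toLam_eq_zero {f : PathAlgebra K (ZMod s)} (h : f ∈ relIdeal K s) : toLam K s f = 0 :=
  ((relIdeal K s).ringCon.eq).2 h

theorem x_mul_x : x K s * x K s = 0 := by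
  rw [x, ← map_mul]
  exact toLam_eq_zero K s (TwoSidedIdeal.subset_span (by simp))

theorem y_mul_y : y K s * y K s = 0 := by
  rw [y, ← map_mul]
  exact toLam_eq_zero K s (TwoSidedIdeal.subset_span (by simp))

theorem x_mul_y_add : x K s * y K s + y K s * x K s = 0 := by
  rw [x, y, ← map_mul, ← map_mul, ← map_add]
  exact toLam_eq_zero K s (TwoSidedIdeal.subset_span (by simp))

theorem e_mul_e (i : ZMod s) : e K s i * e K s i = e K s i := by
  rw [e, ← map_mul, pathE, PathAlgebra.ofPath_mul, Quiver.Path.comp_nil]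

theorem e_mul_x (i : ZMod s) : e K s i * x K s = x K s * e K s (i + 1) := by
  rw [e, e, x, ← map_mul, ← map_mul, pathE, pathE, pathX, Finset.mul_sum, Finset.sum_mul]
  simp only [PathAlgebra.ofPath_nil_mul_ofPath, PathAlgebra.ofPath_mul_ofPath_nil,
    add_left_inj, Finset.sum_ite_eq, Finset.sum_ite_eq', Finset.mem_univ, if_true]

theorem e_mul_y (i : ZMod s) : e K s i * y K s = y K s * e K s (i + 1) := by
  rw [e, e, y, ← map_mul, ← map_mul, pathE, pathE, pathY, Finset.mul_sum, Finset.sum_mul]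
  simp only [PathAlgebra.ofPath_nil_mul_ofPath, PathAlgebra.ofPath_mul_ofPath_nil,
    add_left_inj, Finset.sum_ite_eq, Finset.sum_ite_eq', Finset.mem_univ, if_true]

/-! ### The bimodule resolution -/

/-- The enveloping algebra of the bound quiver algebra. -/
abbrev Env : Type u := EnvAlg K (Lam K s)

variable {K s} in
/-- Left multiplication by `a` on bimodules, as an element of the enveloping algebra. -/
def onLeft (a : Lam K s) : Env K s := EnvAlg.mk K a 1

variable {K s} in
/-- Right multiplication by `a` on bimodules, as an element of the enveloping algebra. -/
def onRight (a : Lam K s) : Env K s := EnvAlg.mk K 1 a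

/-- The element `e i ⊗ e k` of the enveloping algebra. -/
def ee (i k : ZMod s) : Env K s := EnvAlg.mk K (e K s i) (e K s k)

/-- The bimodule `Λ e i ⊗ e k Λ`, realised as the subbimodule of `Λ ⊗ Λ` generated by
`e i ⊗ e k`. -/
def Corner (i k : ZMod s) : Type u :=
  (Submodule.span (Env K s) {ee K s i k} : Submodule (Env K s) (Env K s))

instance (i k : ZMod s) : AddCommGroup (Corner K s i k) :=
  inferInstanceAs (AddCommGroup (Submodule.span (Env K s) {ee K s i k}))

instance (i k : ZMod s) : Module (Env K s) (Corner K s i k) :=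
  inferInstanceAs (Module (Env K s) (Submodule.span (Env K s) {ee K s i k}))

/-- The inclusion of `Λ e i ⊗ e k Λ` into `Λ ⊗ Λ`. -/
def cornerIncl (i k : ZMod s) : Corner K s i k →ₗ[Env K s] Env K s :=
  (Submodule.span (Env K s) {ee K s i k}).subtype

/-- The generator `e i ⊗ e k` of `Λ e i ⊗ e k Λ`. -/
def cornerGen (i k : ZMod s) : Corner K s i k :=
  ⟨ee K s i k, Submodule.mem_span_singleton_self _⟩

theorem cornerIncl_injective (i k : ZMod s) : Function.Injective (cornerIncl K s i k) :=
  Submodule.subtype_injective _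

theorem exists_smul_cornerGen {i k : ZMod s} (z : Corner K s i k) :
    ∃ c : Env K s, z = c • cornerGen K s i k := by
  obtain ⟨z, hz⟩ := z
  obtain ⟨c, rfl⟩ := Submodule.mem_span_singleton.1 hz
  exact ⟨c, rfl⟩

/-- The bimodule `Qⁿ`, the direct sum of the bimodules `Λ e i ⊗ e (i + n) Λ` over the vertices `i`
and the indices `0 ≤ j ≤ n`. -/
def Q (n : ℕ) : Type u := ⨁ p : ZMod s × Fin (n + 1), Corner K s p.1 (p.1 + (n : ZMod s))

instance (n : ℕ) : AddCommGroup (Q K s n) :=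
  inferInstanceAs (AddCommGroup (⨁ p : ZMod s × Fin (n + 1), Corner K s p.1 (p.1 + (n : ZMod s))))

instance (n : ℕ) : Module (Env K s) (Q K s n) :=
  inferInstanceAs
    (Module (Env K s) (⨁ p : ZMod s × Fin (n + 1), Corner K s p.1 (p.1 + (n : ZMod s))))

instance (n : ℕ) [h : ∀ i k, Module.Projective (Env K s) (Corner K s i k)] :
    Module.Projective (Env K s) (Q K s n) :=
  inferInstanceAs
    (Module.Projective (Env K s)
      (⨁ p : ZMod s × Fin (n + 1), Corner K s p.1 (p.1 + (n : ZMod s))))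

/-- The inclusion of the summand with index `(i, j)`. -/
def QIncl (n : ℕ) (i : ZMod s) (j : Fin (n + 1)) :
    Corner K s i (i + (n : ZMod s)) →ₗ[Env K s] Q K s n :=
  DirectSum.lof (Env K s) (ZMod s × Fin (n + 1))
    (fun p => Corner K s p.1 (p.1 + (n : ZMod s))) (i, j)

/-- The generator `b i j` of `Qⁿ`, which is `e i ⊗ e (i + n)` in the summand with index `(i, j)`.
By convention it is zero for an integer `j` outside of the range `0 ≤ j ≤ n`. -/
def gen (n : ℕ) (i : ZMod s) (j : ℤ) : Q K s n :=
  if h : 0 ≤ j ∧ j ≤ n then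
    QIncl K s n i ⟨j.toNat, by omega⟩ (cornerGen K s i (i + (n : ZMod s)))
  else 0

variable {K s} in
/-- The bimodule map from `Λ e i ⊗ e k Λ` that sends `z` to `z • m`. It sends the generator
`e i ⊗ e k` to `e i m e k`, so to `m` if `m` lies in `e i M e k`. -/
def cornerHom {M : Type u} [AddCommGroup M] [Module (Env K s) M] (i k : ZMod s) (m : M) :
    Corner K s i k →ₗ[Env K s] M :=
  (LinearMap.toSpanSingleton (Env K s) M m).comp (cornerIncl K s i k)

variable {K s} in
/-- The bimodule map from `Qⁿ` that sends every generator `b i j` to `m i j`, for elements `m i j`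
of `e i M e (i + n)`. -/
def homOfGen {M : Type u} [AddCommGroup M] [Module (Env K s) M] (n : ℕ)
    (m : ZMod s → Fin (n + 1) → M) : Q K s n →ₗ[Env K s] M :=
  DirectSum.toModule (Env K s) (ZMod s × Fin (n + 1)) M
    fun p => cornerHom p.1 (p.1 + (n : ZMod s)) (m p.1 p.2)

/-- The image of the generator `b i j` of `Qⁿ⁺¹` in `Qⁿ`: it is
`b i (j-1) x + b i j y + (-1)ⁿ⁺¹ (y b (i+1) j + x b (i+1) (j-1))`. -/
def bdGen (n : ℕ) (i : ZMod s) (j : ℤ) : Q K s n :=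
  (onRight (x K s) • gen K s n i (j - 1) + onRight (y K s) • gen K s n i j) +
    (-1 : ℤ) ^ (n + 1) •
      (onLeft (y K s) • gen K s n (i + 1) j + onLeft (x K s) • gen K s n (i + 1) (j - 1))

/-- The differential from `Qⁿ⁺¹` to `Qⁿ`. -/
def bd (n : ℕ) : Q K s (n + 1) →ₗ[Env K s] Q K s n :=
  homOfGen (n + 1) fun i j => bdGen K s n i (j : ℕ)

/-- The augmentation from `Q⁰` to `Λ`, the multiplication map. -/
def multMap : Q K s 0 →ₗ[Env K s] Lam K s :=
  homOfGen 0 fun _ _ => 1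

variable {K s} in
theorem hom_ext {M : Type u} [AddCommGroup M] [Module (Env K s) M] {n : ℕ}
    {f g : Q K s n →ₗ[Env K s] M}
    (h : ∀ (i : ZMod s) (j : ℤ), f (gen K s n i j) = g (gen K s n i j)) : f = g := by
  refine DirectSum.linearMap_ext _ fun p => LinearMap.ext fun z => ?_
  obtain ⟨i, j, hj⟩ := p
  obtain ⟨c, rfl⟩ := exists_smul_cornerGen K s z
  have h' := h i (j : ℤ)
  rw [gen, dif_pos (by omega)] at h'
  rw [map_smul, map_smul]
  exact congrArg (c • ·) h'

variable {K s} in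
theorem homOfGen_gen {M : Type u} [AddCommGroup M] [Module (Env K s) M] (n : ℕ)
    (m : ZMod s → Fin (n + 1) → M) (i : ZMod s) (j : Fin (n + 1)) :
    homOfGen n m (gen K s n i (j : ℕ)) = ee K s i (i + (n : ZMod s)) • m i j := by
  rw [gen, dif_pos (by omega)]
  exact DirectSum.toModule_lof _ _ _

theorem ee_gen (n : ℕ) (i : ZMod s) (j : ℤ) (k : ZMod s) (hk : k = i + n) :
    ee K s i k • gen K s n i j = gen K s n i j := by
  subst hk
  rw [gen]
  split_ifs with h
  · rw [← map_smul]
    congr 1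
    apply cornerIncl_injective
    rw [map_smul]
    change ee K s i (i + n) * ee K s i (i + n) = ee K s i (i + n)
    rw [ee, EnvAlg.mk_mul_mk, e_mul_e, e_mul_e]
  · exact smul_zero _

theorem onRight_mul (a c : Lam K s) : onRight a * onRight c = (onRight (c * a) : Env K s) := by
  rw [onRight, onRight, onRight, EnvAlg.mk_mul_mk, one_mul]

theorem onLeft_mul (a c : Lam K s) : onLeft a * onLeft c = (onLeft (a * c) : Env K s) := by
  rw [onLeft, onLeft, onLeft, EnvAlg.mk_mul_mk, one_mul]

theorem onLeft_onRight (a c : Lam K s) :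
    onLeft a * onRight c = (onRight c * onLeft a : Env K s) := by
  rw [onLeft, onRight, EnvAlg.mk_mul_mk, EnvAlg.mk_mul_mk,
    one_mul, mul_one, one_mul, mul_one]

theorem onRight_add (a c : Lam K s) : onRight (a + c) = (onRight a + onRight c : Env K s) := by
  rw [onRight, onRight, onRight, EnvAlg.mk_add]

theorem onLeft_add (a c : Lam K s) : onLeft (a + c) = (onLeft a + onLeft c : Env K s) := by
  rw [onLeft, onLeft, onLeft, EnvAlg.add_mk]

theorem onRight_zero : (onRight (0 : Lam K s) : Env K s) = 0 := by
  rw [onRight, EnvAlg.mk_zero]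

theorem onLeft_zero : (onLeft (0 : Lam K s) : Env K s) = 0 := by
  rw [onLeft, EnvAlg.zero_mk]

theorem ee_onRight {z : Lam K s} (hz : ∀ i, e K s i * z = z * e K s (i + 1)) (i k : ZMod s) :
    ee K s i (k + 1) * onRight z = onRight z * ee K s i k := by
  rw [ee, onRight, ee, EnvAlg.mk_mul_mk, EnvAlg.mk_mul_mk, one_mul, mul_one, hz]

theorem ee_onLeft {z : Lam K s} (hz : ∀ i, e K s i * z = z * e K s (i + 1)) (i k : ZMod s) :
    ee K s i k * onLeft z = onLeft z * ee K s (i + 1) k := by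
  rw [ee, onLeft, ee, EnvAlg.mk_mul_mk, EnvAlg.mk_mul_mk,
    one_mul, mul_one, hz]

theorem ee_bdGen (n : ℕ) (i : ZMod s) (j : ℤ) :
    ee K s i (i + ((n + 1 : ℕ) : ZMod s)) • bdGen K s n i j = bdGen K s n i j := by
  have hk : i + ((n + 1 : ℕ) : ZMod s) = i + (n : ZMod s) + 1 := by push_cast; ring
  have hR : ∀ {z : Lam K s}, (∀ i, e K s i * z = z * e K s (i + 1)) → ∀ j' : ℤ,
      ee K s i (i + ((n + 1 : ℕ) : ZMod s)) • onRight z • gen K s n i j' =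
        onRight z • gen K s n i j' := fun {z} hz j' => by
    rw [hk, ← mul_smul, ee_onRight K s hz, mul_smul, ee_gen K s n i j' _ rfl]
  have hL : ∀ {z : Lam K s}, (∀ i, e K s i * z = z * e K s (i + 1)) → ∀ j' : ℤ,
      ee K s i (i + ((n + 1 : ℕ) : ZMod s)) • onLeft z • gen K s n (i + 1) j' =
        onLeft z • gen K s n (i + 1) j' := fun {z} hz j' => by
    rw [← mul_smul, ee_onLeft K s hz, mul_smul, ee_gen K s n (i + 1) j' _ (by push_cast; ring)]
  rw [bdGen, smul_add, smul_add, smul_comm _ ((-1 : ℤ) ^ (n + 1)), smul_add, hR (e_mul_x K s), hR (e_mul_y K s),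
    hL (e_mul_x K s), hL (e_mul_y K s)]

theorem gen_of_not {n : ℕ} {i : ZMod s} {j : ℤ} (h : ¬(0 ≤ j ∧ j ≤ n)) : gen K s n i j = 0 :=
  dif_neg h

theorem bd_gen (n : ℕ) (i : ZMod s) (j : ℤ) :
    bd K s n (gen K s (n + 1) i j) = bdGen K s n i j := by
  by_cases h : 0 ≤ j ∧ j ≤ (n + 1 : ℕ)
  · obtain ⟨l, rfl⟩ : ∃ l : Fin (n + 1 + 1), ((l : ℕ) : ℤ) = j :=
      ⟨⟨j.toNat, by omega⟩, by simp only []; omega⟩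
    rw [bd, homOfGen_gen, ee_bdGen]
  · rw [gen_of_not K s h, map_zero, bdGen, gen_of_not K s (by omega), gen_of_not K s (by omega),
      gen_of_not K s (by omega), gen_of_not K s (by omega)]
    simp only [smul_zero, add_zero]

theorem bd_comp_bd (n : ℕ) : (bd K s n).comp (bd K s (n + 1)) = 0 := by
  refine hom_ext fun i j => ?_
  rw [LinearMap.comp_apply, bd_gen, LinearMap.zero_apply, bdGen]
  simp only [map_add, map_smul, map_zsmul, bd_gen]
  have hR : ∀ a c : Lam K s, ∀ q : Q K s n, onRight a • onRight c • q = onRight (c * a) • q :=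
    fun a c q => by rw [← mul_smul, onRight_mul]
  have hL : ∀ a c : Lam K s, ∀ q : Q K s n, onLeft a • onLeft c • q = onLeft (a * c) • q :=
    fun a c q => by rw [← mul_smul, onLeft_mul]
  have hLR : ∀ a c : Lam K s, ∀ q : Q K s n,
      onLeft a • onRight c • q = onRight c • onLeft a • q :=
    fun a c q => by rw [← mul_smul, onLeft_onRight, mul_smul]
  have hRx : ∀ q : Q K s n, onRight (x K s * y K s) • q = - onRight (y K s * x K s) • q :=
    fun q => by
      rw [neg_smul, eq_neg_iff_add_eq_zero, ← add_smul, ← onRight_add, x_mul_y_add, onRight_zero,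
        zero_smul]
  have hLx : ∀ q : Q K s n, onLeft (x K s * y K s) • q = - onLeft (y K s * x K s) • q :=
    fun q => by
      rw [neg_smul, eq_neg_iff_add_eq_zero, ← add_smul, ← onLeft_add, x_mul_y_add, onLeft_zero,
        zero_smul]
  have hc : ∀ (a : Env K s) (k : ℤ) (q : Q K s n), a • k • q = k • a • q :=
    fun a k q => smul_comm a k q
  simp only [bdGen, smul_add, hR, hL, hLR, hc, x_mul_x, y_mul_y, onRight_zero, onLeft_zero,
    zero_smul, smul_zero, hRx, hLx, neg_smul, smul_neg]
  rw [pow_succ (-1 : ℤ) (n + 1)]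
  simp only [mul_neg, mul_one, neg_smul]
  abel

theorem multMap_comp_bd : (multMap K s).comp (bd K s 0) = 0 := by
  have h : ∀ (i : ZMod s) (j : ℤ), multMap K s (gen K s 0 i j) = if j = 0 then e K s i else 0 := by
    intro i j
    split_ifs with hj
    · subst hj
      have := homOfGen_gen (K := K) (s := s) 0 (fun _ _ => (1 : Lam K s)) i 0
      refine this.trans ?_
      rw [ee, EnvAlg.mk_smul, mul_one, Nat.cast_zero, add_zero, e_mul_e]
    · rw [gen_of_not K s (by omega), map_zero]
  have hl : ∀ a z : Lam K s, (onLeft a : Env K s) • z = a * z := fun a z => by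
    rw [onLeft, EnvAlg.mk_smul, mul_one]
  have hr : ∀ a z : Lam K s, (onRight a : Env K s) • z = z * a := fun a z => by
    rw [onRight, EnvAlg.mk_smul, one_mul]
  refine hom_ext fun i j => ?_
  rw [LinearMap.comp_apply, bd_gen, LinearMap.zero_apply, bdGen]
  simp only [map_add, map_smul, map_zsmul, h, hl, hr, ite_mul, mul_ite, zero_mul, mul_zero,
    e_mul_x, e_mul_y]
  rw [zero_add, pow_one, neg_smul, one_smul]
  abel

instance (i k : ZMod s) : Module.Projective (Env K s) (Corner K s i k) := by
  refine Module.Projective.of_split (cornerIncl K s i k)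
    (LinearMap.toSpanSingleton (Env K s) _ (cornerGen K s i k)) (LinearMap.ext fun z => ?_)
  obtain ⟨c, rfl⟩ := exists_smul_cornerGen K s z
  rw [LinearMap.comp_apply, map_smul, map_smul]
  congr 1
  apply cornerIncl_injective
  rw [LinearMap.toSpanSingleton_apply, map_smul]
  change ee K s i k * ee K s i k = ee K s i k
  rw [ee, EnvAlg.mk_mul_mk, e_mul_e, e_mul_e]

/-- The complex of bimodules formed by the `Qⁿ` and the differentials. -/
def QComplex : ChainComplex (ModuleCat.{u} (Env K s)) ℕ :=
  ChainComplex.of (fun n => ModuleCat.of (Env K s) (Q K s n)) (fun n => ModuleCat.ofHom (bd K s n))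
    fun n => by
      rw [← ModuleCat.ofHom_comp, bd_comp_bd]
      rfl

theorem QComplex_d (n : ℕ) : (QComplex K s).d (n + 1) n = ModuleCat.ofHom (bd K s n) :=
  (dif_pos rfl).trans (Category.id_comp _)

/-- The multiplication map, as a map from the complex to the algebra placed in degree `0`. -/
def QAug : QComplex K s ⟶ (ChainComplex.single₀ (ModuleCat.{u} (Env K s))).obj
    (regularBimodule K (Lam K s)) :=
  (ChainComplex.toSingle₀Equiv (QComplex K s) (regularBimodule K (Lam K s))).symm
    ⟨ModuleCat.ofHom (multMap K s), by
      rw [QComplex_d]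
      refine (ModuleCat.ofHom_comp (bd K s 0) (multMap K s)).symm.trans ?_
      rw [multMap_comp_bd]
      rfl⟩

/-- The projective resolution given by the complex, provided that its augmentation is a
quasi-isomorphism, that is, provided that the augmented complex is exact. -/
def QResolution (h : QuasiIso (QAug K s)) :
    ProjectiveResolution (regularBimodule K (Lam K s)) where
  complex := QComplex K s
  projective n := (IsProjective.iff_projective (R := Env K s) (Q K s n)).1 inferInstance
  π := QAug K s
  quasiIso := h

/-! ### The standard maps -/

/-- The bimodule map `Qⁿ → Λ` that sends `b i j` to `z` (for `z` in `e i Λ e (i + n)`) and all other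
generators to `0`. -/
def elemHom (n : ℕ) (i : ZMod s) (j : Fin (n + 1)) (z : Lam K s) : Q K s n →ₗ[Env K s] Lam K s :=
  homOfGen n fun k l => if k = i ∧ l = j then z else 0

theorem elemHom_gen (n : ℕ) (i : ZMod s) (j : Fin (n + 1)) (z : Lam K s)
    (hz : e K s i * z * e K s (i + (n : ZMod s)) = z) (k : ZMod s) (l : Fin (n + 1)) :
    elemHom K s n i j z (gen K s n k (l : ℕ)) = if k = i ∧ l = j then z else 0 := by
  rw [elemHom, homOfGen_gen]
  split_ifs with h
  · rw [h.1, ee, EnvAlg.mk_smul, hz]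
  · rw [smul_zero]

/-- The map `elemHom`, as a morphism from the `n`-th term of the complex. -/
def elemMap (n : ℕ) (i : ZMod s) (j : Fin (n + 1)) (z : Lam K s) :
    (QComplex K s).X n ⟶ regularBimodule K (Lam K s) :=
  ModuleCat.ofHom (elemHom K s n i j z)

/-- The map `α i j` in degree `n`, used for `n ≡ 0` modulo `s`: it sends `b i j` to `e i`. -/
def alpha (n : ℕ) (i : ZMod s) (j : Fin (n + 1)) := elemMap K s n i j (e K s i)

/-- The map `β i j` in degree `n`, used for `n ≡ 1` modulo `s`: it sends `b i j` to `e i x`. -/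
def beta (n : ℕ) (i : ZMod s) (j : Fin (n + 1)) := elemMap K s n i j (e K s i * x K s)

/-- The map `γ i j` in degree `n`, used for `n ≡ 1` modulo `s`: it sends `b i j` to `e i y`. -/
def gamma (n : ℕ) (i : ZMod s) (j : Fin (n + 1)) := elemMap K s n i j (e K s i * y K s)

/-- The map `δ i j` in degree `n`, used for `n ≡ 2` modulo `s`: it sends `b i j` to `e i x y`. -/
def delta (n : ℕ) (i : ZMod s) (j : Fin (n + 1)) := elemMap K s n i j (e K s i * x K s * y K s)

end CircAlg

end

/-!
The algebra `Λ` is a version of the exterior algebra in `x` and `y` that is graded by the vertices,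
and the complex `Q` is its Koszul bimodule resolution.

*Exactness.* The elements `e i`, `e i x`, `e i y`, `e i xy` form a basis of `Λ`: they span by
induction on the length of paths, and their coefficients are read off from a representation of `Λ`
by matrices indexed by the vertices, with entries in the exterior algebra on two generators
(`repr`, `lam_expand`). The part of the differential that involves the right action only is that of
the Koszul complex of right modules. This complex has an explicit contracting homotopy, whose left
linear extension to `Q` is `homotopy`. The other part of the differential takes values in
`xQ + yQ`, so the defect `D = dh + hd - 1` is a left linear map with values in `xQ + yQ`
(`defect_mem`, `defectZero_mem`). Any three factors from `{x, y}` have product zero in `Λ`, so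
`D³ = 0`, and a cycle `z` is the boundary of `hz - hDz + hD²z` (`exists_bd_eq`).

*Cohomology.* A bimodule map from `Qⁿ` to `Λ` amounts to a choice of elements of
`e i Λ e (i + n)`. Since `s ≥ 3`, these corners vanish unless `n` is `0`, `1` or `2` modulo `s`, and
there they are spanned by `e i`, by `e i x` and `e i y`, or by `e i xy`. So the cochain complex falls
apart into pieces of three terms; for `s = 3` these are adjacent, but the differentials between them
are zero (`cobd_eq_zero_of_cast_succ_eq_zero`). With the sign `ε = (-1)ⁿ` for `n = ms`, the
differentials of such a piece are built from the operator `c ↦ (i ↦ c i - ε c (i + 1))` on functions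
on `ℤ/s` (`coordX_cobd`, `coordY_cobd`, `coordXY_cobd`). If `ε = -1 ≠ 1` and `s` is odd, then this operator
is bijective (`exists_add_add_one`), and the three cohomology groups vanish. If `ε = 1`, then its
kernel consists of the constant functions, and its image consists of the functions with sum zero,
which has the indicator function of the vertex `s - 1 = -1` as a complement
(`exists_sub_add_one`). This gives the listed bases.
-/

noncomputable section

namespace CircAlg

/-! ### The standard basis of the algebra -/

variable (K : Type u) [Field K]

/-- The exterior algebra on two generators, realised as the quaternion algebra with parameters
zero: `i² = j² = 0` and `ij = -ji = k`. -/
abbrev Ext2 : Type u := QuaternionAlgebra K 0 0 0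

/-- The first generator of the exterior algebra. -/
def extX : Ext2 K := ⟨0, 1, 0, 0⟩

/-- The second generator of the exterior algebra. -/
def extY : Ext2 K := ⟨0, 0, 1, 0⟩

/-- The product of the two generators of the exterior algebra. -/
def extXY : Ext2 K := ⟨0, 0, 0, 1⟩

theorem extX_mul_extX : extX K * extX K = 0 := by
  ext <;> simp [extX]

theorem extY_mul_extY : extY K * extY K = 0 := by
  ext <;> simp [extY]

theorem extX_mul_extY : extX K * extY K = extXY K := by
  ext <;> simp [extX, extY, extXY]

theorem extX_mul_extY_add : extX K * extY K + extY K * extX K = 0 := by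
  ext <;> simp [extX, extY]

variable {s : ℕ}

/-- The generator of the exterior algebra attached to an arrow. -/
def arrowWeight : {i j : ZMod s} → CircArrow s i j → Ext2 K
  | _, _, .a _ => extX K
  | _, _, .b _ => extY K

/-- The product of the weights of the arrows of a path. -/
def pathWeight {i : ZMod s} : {j : ZMod s} → Quiver.Path i j → Ext2 K
  | _, .nil => 1
  | _, .cons p c => pathWeight p * arrowWeight K c

theorem pathWeight_comp {i j k : ZMod s} (p : Quiver.Path i j) (q : Quiver.Path j k) :
    pathWeight K (p.comp q) = pathWeight K p * pathWeight K q := by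
  induction q with
  | nil => simp [pathWeight]
  | cons q c ih => simp [pathWeight, ih, mul_assoc]

variable (s) [NeZero s]

/-- The linear map underlying `pathRepr`. -/
def pathReprLin : PathAlgebra K (ZMod s) →ₗ[K] Matrix (ZMod s) (ZMod s) (Ext2 K) :=
  Finsupp.lift (Matrix (ZMod s) (ZMod s) (Ext2 K)) K (Σ i j : ZMod s, Quiver.Path i j)
    fun p => Matrix.single p.1 p.2.1 (pathWeight K p.2.2)

theorem pathReprLin_ofPath {i j : ZMod s} (p : Quiver.Path i j) :
    pathReprLin K s (PathAlgebra.ofPath K p) = Matrix.single i j (pathWeight K p) :=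
  Eq.trans (Finsupp.sum_single_index
    (h := fun (p : Σ i j : ZMod s, Quiver.Path i j) (c : K) =>
      c • (Matrix.single p.1 p.2.1 (pathWeight K p.2.2) : Matrix (ZMod s) (ZMod s) (Ext2 K)))
    (zero_smul K _)) (one_smul K _)

/-- The representation of the path algebra by matrices over the exterior algebra on two
generators: a path from `i` to `j` goes to the matrix with its weight at the place `(i, j)`. -/
def pathRepr : PathAlgebra K (ZMod s) →ₐ[K] Matrix (ZMod s) (ZMod s) (Ext2 K) :=
  AlgHom.ofLinearMap (pathReprLin K s)
    (by
      change pathReprLin K s (∑ v, PathAlgebra.ofPath K (Quiver.Path.nil : Quiver.Path v v)) = 1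
      simp only [map_sum, pathReprLin_ofPath, pathWeight]
      exact Matrix.sum_single_one)
    (fun f g => by
      induction f using PathAlgebra.span_induction with
      | zero => simp only [zero_mul, map_zero]
      | add f f' hf hf' => simp only [add_mul, map_add, hf, hf']
      | smul_ofPath c i j p =>
        induction g using PathAlgebra.span_induction with
        | zero => simp only [mul_zero, map_zero]
        | add g g' hg hg' => simp only [mul_add, map_add, hg, hg']
        | smul_ofPath c' k l q =>
          simp only [smul_mul_assoc, mul_smul_comm, map_smul, pathReprLin_ofPath]
          congr 2
          by_cases h : k = j
          · subst h
            rw [PathAlgebra.ofPath_mul, pathReprLin_ofPath, pathWeight_comp,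
              Matrix.single_mul_single_same]
          · rw [PathAlgebra.ofPath_mul_ne K _ _ h, map_zero,
              Matrix.single_mul_single_of_ne _ _ _ _ (Ne.symm h)])

theorem pathRepr_ofPath {i j : ZMod s} (p : Quiver.Path i j) :
    pathRepr K s (PathAlgebra.ofPath K p) = Matrix.single i j (pathWeight K p) :=
  pathReprLin_ofPath K s p

theorem pathRepr_pathX :
    pathRepr K s (pathX K s) = ∑ i, Matrix.single i (i + 1) (extX K) := by
  simp only [pathX, map_sum, pathRepr_ofPath]
  refine Finset.sum_congr rfl fun i _ => ?_
  congr 1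
  exact one_mul _

theorem pathRepr_pathY :
    pathRepr K s (pathY K s) = ∑ i, Matrix.single i (i + 1) (extY K) := by
  simp only [pathY, map_sum, pathRepr_ofPath]
  refine Finset.sum_congr rfl fun i _ => ?_
  congr 1
  exact one_mul _

theorem sum_single_mul_sum_single (a b : Ext2 K) :
    (∑ i : ZMod s, Matrix.single i (i + 1) a) * (∑ i : ZMod s, Matrix.single i (i + 1) b) =
      ∑ i : ZMod s, Matrix.single i (i + 2) (a * b) := by
  rw [Finset.sum_mul]
  refine Finset.sum_congr rfl fun i _ => ?_
  rw [Finset.mul_sum, Finset.sum_eq_single (i + 1), Matrix.single_mul_single_same,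
    add_assoc, one_add_one_eq_two]
  · intro k _ hk
    exact Matrix.single_mul_single_of_ne _ _ _ _ hk.symm _
  · exact fun h => absurd (Finset.mem_univ _) h

/-- The defining relations of `Λ` hold in the exterior algebra. -/
theorem relIdeal_le_ker : relIdeal K s ≤ TwoSidedIdeal.ker (pathRepr K s) := by
  refine TwoSidedIdeal.span_le.2 ?_
  rintro f (rfl | rfl | rfl) <;> rw [SetLike.mem_coe, TwoSidedIdeal.mem_ker]
  · rw [map_mul, pathRepr_pathX, sum_single_mul_sum_single, extX_mul_extX]
    exact Finset.sum_eq_zero fun i _ => Matrix.single_zero i _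
  · rw [map_add, map_mul, map_mul, pathRepr_pathX, pathRepr_pathY, sum_single_mul_sum_single,
      sum_single_mul_sum_single, ← Finset.sum_add_distrib]
    refine Finset.sum_eq_zero fun i _ => ?_
    rw [← Matrix.single_add, extX_mul_extY_add, Matrix.single_zero]
  · rw [map_mul, pathRepr_pathY, sum_single_mul_sum_single, extY_mul_extY]
    exact Finset.sum_eq_zero fun i _ => Matrix.single_zero i _

/-- The representation of `Λ` by matrices over the exterior algebra on two generators. -/
def repr : Lam K s →ₐ[K] Matrix (ZMod s) (ZMod s) (Ext2 K) :=
  (relIdeal K s).ringCon.liftₐ (pathRepr K s) fun f g h => by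
    have h' := relIdeal_le_ker K s ((TwoSidedIdeal.rel_iff _ _ _).1 h)
    rw [TwoSidedIdeal.mem_ker, map_sub, sub_eq_zero] at h'
    exact h'

theorem repr_toLam (f : PathAlgebra K (ZMod s)) : repr K s (toLam K s f) = pathRepr K s f := rfl

theorem repr_e (i : ZMod s) : repr K s (e K s i) = Matrix.single i i 1 :=
  (repr_toLam K s _).trans (pathRepr_ofPath K s _)

theorem single_mul_sum_single (i j : ZMod s) (a b : Ext2 K) :
    Matrix.single i j a * (∑ k : ZMod s, Matrix.single k (k + 1) b) =
      Matrix.single i (j + 1) (a * b) := by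
  rw [Finset.mul_sum, Finset.sum_eq_single j, Matrix.single_mul_single_same]
  · intro k _ hk
    exact Matrix.single_mul_single_of_ne _ _ _ _ hk.symm _
  · exact fun h => absurd (Finset.mem_univ _) h

theorem repr_e_mul_x (i : ZMod s) :
    repr K s (e K s i * x K s) = Matrix.single i (i + 1) (extX K) := by
  rw [map_mul, repr_e, x, repr_toLam, pathRepr_pathX, single_mul_sum_single, one_mul]

theorem repr_e_mul_y (i : ZMod s) :
    repr K s (e K s i * y K s) = Matrix.single i (i + 1) (extY K) := by
  rw [map_mul, repr_e, y, repr_toLam, pathRepr_pathY, single_mul_sum_single, one_mul]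

theorem repr_e_mul_x_mul_y (i : ZMod s) :
    repr K s (e K s i * x K s * y K s) = Matrix.single i (i + 2) (extXY K) := by
  rw [map_mul, repr_e_mul_x, y, repr_toLam, pathRepr_pathY, single_mul_sum_single, extX_mul_extY,
    add_assoc, one_add_one_eq_two]

/-- The coefficient of `e i`. -/
def coeffE (i : ZMod s) : Lam K s →ₗ[K] K :=
  QuaternionAlgebra.reₗ _ _ _ ∘ₗ Matrix.entryLinearMap K (Ext2 K) i i ∘ₗ (repr K s).toLinearMap

/-- The coefficient of `e i x`. -/
def coeffX (i : ZMod s) : Lam K s →ₗ[K] K :=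
  QuaternionAlgebra.imIₗ _ _ _ ∘ₗ
    Matrix.entryLinearMap K (Ext2 K) i (i + 1) ∘ₗ (repr K s).toLinearMap

/-- The coefficient of `e i y`. -/
def coeffY (i : ZMod s) : Lam K s →ₗ[K] K :=
  QuaternionAlgebra.imJₗ _ _ _ ∘ₗ
    Matrix.entryLinearMap K (Ext2 K) i (i + 1) ∘ₗ (repr K s).toLinearMap

/-- The coefficient of `e i xy`. -/
def coeffXY (i : ZMod s) : Lam K s →ₗ[K] K :=
  QuaternionAlgebra.imKₗ _ _ _ ∘ₗ
    Matrix.entryLinearMap K (Ext2 K) i (i + 2) ∘ₗ (repr K s).toLinearMap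

theorem coeffE_apply (i : ZMod s) (z : Lam K s) : coeffE K s i z = (repr K s z i i).re := rfl

theorem coeffX_apply (i : ZMod s) (z : Lam K s) :
    coeffX K s i z = (repr K s z i (i + 1)).imI := rfl

theorem coeffY_apply (i : ZMod s) (z : Lam K s) :
    coeffY K s i z = (repr K s z i (i + 1)).imJ := rfl

theorem coeffXY_apply (i : ZMod s) (z : Lam K s) :
    coeffXY K s i z = (repr K s z i (i + 2)).imK := rfl

section coefficients

variable (i k : ZMod s)

theorem coeffE_e : coeffE K s i (e K s k) = if k = i then 1 else 0 := by
  rw [coeffE_apply, repr_e, Matrix.single_apply]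
  split_ifs <;> simp_all

theorem coeffE_e_x : coeffE K s i (e K s k * x K s) = 0 := by
  rw [coeffE_apply, repr_e_mul_x, Matrix.single_apply]
  split_ifs <;> simp [extX]

theorem coeffE_e_y : coeffE K s i (e K s k * y K s) = 0 := by
  rw [coeffE_apply, repr_e_mul_y, Matrix.single_apply]
  split_ifs <;> simp [extY]

theorem coeffE_e_x_y : coeffE K s i (e K s k * x K s * y K s) = 0 := by
  rw [coeffE_apply, repr_e_mul_x_mul_y, Matrix.single_apply]
  split_ifs <;> simp [extXY]

theorem coeffX_e : coeffX K s i (e K s k) = 0 := by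
  rw [coeffX_apply, repr_e, Matrix.single_apply]
  split_ifs <;> simp

theorem coeffX_e_x : coeffX K s i (e K s k * x K s) = if k = i then 1 else 0 := by
  rw [coeffX_apply, repr_e_mul_x, Matrix.single_apply]
  split_ifs <;> simp_all [extX]

theorem coeffX_e_y : coeffX K s i (e K s k * y K s) = 0 := by
  rw [coeffX_apply, repr_e_mul_y, Matrix.single_apply]
  split_ifs <;> simp [extY]

theorem coeffX_e_x_y : coeffX K s i (e K s k * x K s * y K s) = 0 := by
  rw [coeffX_apply, repr_e_mul_x_mul_y, Matrix.single_apply]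
  split_ifs <;> simp [extXY]

theorem coeffY_e : coeffY K s i (e K s k) = 0 := by
  rw [coeffY_apply, repr_e, Matrix.single_apply]
  split_ifs <;> simp

theorem coeffY_e_x : coeffY K s i (e K s k * x K s) = 0 := by
  rw [coeffY_apply, repr_e_mul_x, Matrix.single_apply]
  split_ifs <;> simp [extX]

theorem coeffY_e_y : coeffY K s i (e K s k * y K s) = if k = i then 1 else 0 := by
  rw [coeffY_apply, repr_e_mul_y, Matrix.single_apply]
  split_ifs <;> simp_all [extY]

theorem coeffY_e_x_y : coeffY K s i (e K s k * x K s * y K s) = 0 := by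
  rw [coeffY_apply, repr_e_mul_x_mul_y, Matrix.single_apply]
  split_ifs <;> simp [extXY]

theorem coeffXY_e : coeffXY K s i (e K s k) = 0 := by
  rw [coeffXY_apply, repr_e, Matrix.single_apply]
  split_ifs <;> simp

theorem coeffXY_e_x : coeffXY K s i (e K s k * x K s) = 0 := by
  rw [coeffXY_apply, repr_e_mul_x, Matrix.single_apply]
  split_ifs <;> simp [extX]

theorem coeffXY_e_y : coeffXY K s i (e K s k * y K s) = 0 := by
  rw [coeffXY_apply, repr_e_mul_y, Matrix.single_apply]
  split_ifs <;> simp [extY]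

theorem coeffXY_e_x_y :
    coeffXY K s i (e K s k * x K s * y K s) = if k = i then 1 else 0 := by
  rw [coeffXY_apply, repr_e_mul_x_mul_y, Matrix.single_apply]
  split_ifs <;> simp_all [extXY]

end coefficients

theorem repr_e_mul_apply (i j : ZMod s) (z : Lam K s) :
    repr K s (e K s i * z) i j = repr K s z i j := by
  rw [map_mul, repr_e, Matrix.single_mul_apply_same, one_mul]

theorem toLam_ofPath_nil (i : ZMod s) :
    toLam K s (PathAlgebra.ofPath K (Quiver.Path.nil : Quiver.Path i i)) = e K s i := rfl

theorem e_mul_e_of_ne {i j : ZMod s} (h : i ≠ j) : e K s i * e K s j = 0 := by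
  rw [e, e, ← map_mul, pathE, pathE, PathAlgebra.ofPath_mul_ne K _ _ h.symm, map_zero]

theorem e_mul_e_eq_ite (i j : ZMod s) : e K s i * e K s j = if i = j then e K s i else 0 := by
  split_ifs with h
  · rw [← h, e_mul_e]
  · exact e_mul_e_of_ne K s h

theorem sum_e : ∑ i, e K s i = 1 := by
  simp only [e, ← map_sum]
  exact map_one _

theorem toLam_arrowA (i : ZMod s) :
    toLam K s (PathAlgebra.ofPath K (arrowA s i).toPath) = e K s i * x K s := by
  rw [e, x, ← map_mul, pathE, pathX, Finset.mul_sum]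
  simp only [PathAlgebra.ofPath_nil_mul_ofPath, Finset.sum_ite_eq', Finset.mem_univ, if_true]

theorem toLam_arrowB (i : ZMod s) :
    toLam K s (PathAlgebra.ofPath K (arrowB s i).toPath) = e K s i * y K s := by
  rw [e, y, ← map_mul, pathE, pathY, Finset.mul_sum]
  simp only [PathAlgebra.ofPath_nil_mul_ofPath, Finset.sum_ite_eq', Finset.mem_univ, if_true]

theorem y_mul_x : y K s * x K s = -(x K s * y K s) :=
  eq_neg_of_add_eq_zero_right (x_mul_y_add K s)

/-- The span of `e i`, `e i x`, `e i y` and `e i xy`. -/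
def rowSpan (i : ZMod s) : Submodule K (Lam K s) :=
  Submodule.span K {e K s i, e K s i * x K s, e K s i * y K s, e K s i * x K s * y K s}

theorem rowSpan_mul_x {i : ZMod s} {z : Lam K s} (hz : z ∈ rowSpan K s i) :
    z * x K s ∈ rowSpan K s i := by
  refine (Submodule.span_le (p := (rowSpan K s i).comap (LinearMap.mulRight K (x K s)))).2 ?_ hz
  rintro w (rfl | rfl | rfl | rfl) <;>
    rw [SetLike.mem_coe, Submodule.mem_comap, LinearMap.mulRight_apply]
  · exact Submodule.subset_span (by simp)
  · rw [mul_assoc, x_mul_x, mul_zero]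
    exact zero_mem _
  · rw [mul_assoc, y_mul_x, mul_neg, ← mul_assoc]
    exact neg_mem (Submodule.subset_span (by simp))
  · rw [mul_assoc, y_mul_x, mul_neg, mul_assoc, ← mul_assoc (x K s), x_mul_x, zero_mul, mul_zero,
      neg_zero]
    exact zero_mem _

theorem rowSpan_mul_y {i : ZMod s} {z : Lam K s} (hz : z ∈ rowSpan K s i) :
    z * y K s ∈ rowSpan K s i := by
  refine (Submodule.span_le (p := (rowSpan K s i).comap (LinearMap.mulRight K (y K s)))).2 ?_ hz
  rintro w (rfl | rfl | rfl | rfl) <;>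
    rw [SetLike.mem_coe, Submodule.mem_comap, LinearMap.mulRight_apply]
  · exact Submodule.subset_span (by simp)
  · exact Submodule.subset_span (by simp)
  · rw [mul_assoc, y_mul_y, mul_zero]
    exact zero_mem _
  · rw [mul_assoc, y_mul_y, mul_zero]
    exact zero_mem _

/-- Paths starting at `i` lie in the span of `e i`, `e i x`, `e i y` and `e i xy`, since this span
is closed under right multiplication by `x` and `y`. -/
theorem toLam_ofPath_mem_rowSpan {i j : ZMod s} (p : Quiver.Path i j) :
    toLam K s (PathAlgebra.ofPath K p) ∈ rowSpan K s i := by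
  induction p with
  | nil => exact Submodule.subset_span (by simp [toLam_ofPath_nil])
  | cons p c ih =>
    have hc : ∀ {k l : ZMod s} (p : Quiver.Path i k) (c : CircArrow s k l),
        toLam K s (PathAlgebra.ofPath K p) ∈ rowSpan K s i →
        toLam K s (PathAlgebra.ofPath K (p.cons c)) ∈ rowSpan K s i := by
      intro k l p c ih
      have he : toLam K s (PathAlgebra.ofPath K p) * e K s k =
          toLam K s (PathAlgebra.ofPath K p) := by
        rw [← toLam_ofPath_nil, ← map_mul, PathAlgebra.ofPath_mul, Quiver.Path.comp_nil]
      cases c with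
      | a =>
        have h : PathAlgebra.ofPath K (p.cons (CircArrow.a k)) =
            PathAlgebra.ofPath K p * PathAlgebra.ofPath K (arrowA s k).toPath :=
          (PathAlgebra.ofPath_mul K p (arrowA s k).toPath).symm
        rw [h, map_mul, toLam_arrowA, ← mul_assoc, he]
        exact rowSpan_mul_x K s ih
      | b =>
        have h : PathAlgebra.ofPath K (p.cons (CircArrow.b k)) =
            PathAlgebra.ofPath K p * PathAlgebra.ofPath K (arrowB s k).toPath :=
          (PathAlgebra.ofPath_mul K p (arrowB s k).toPath).symm
        rw [h, map_mul, toLam_arrowB, ← mul_assoc, he]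
        exact rowSpan_mul_y K s ih
    exact hc p c ih

theorem iSup_rowSpan : ⨆ i, rowSpan K s i = ⊤ := by
  refine eq_top_iff.2 fun z _ => ?_
  obtain ⟨f, rfl⟩ := RingCon.mkₐ_surjective (α := K) (relIdeal K s).ringCon z
  change toLam K s f ∈ _
  induction f using PathAlgebra.span_induction with
  | zero => rw [map_zero]; exact zero_mem _
  | add f g hf hg => rw [map_add]; exact add_mem (hf trivial) (hg trivial)
  | smul_ofPath c i j p =>
    rw [map_smul]
    exact Submodule.smul_mem _ _
      (Submodule.mem_iSup_of_mem i (toLam_ofPath_mem_rowSpan K s p))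

/-- An additive property of the elements of `Λ` holds for all of them if it holds for the scalar
multiples of the standard basis elements. -/
theorem lam_induction {P : Lam K s → Prop} (zero : P 0) (add : ∀ z w, P z → P w → P (z + w))
    (basis : ∀ (c : K) (i : ZMod s), P (c • e K s i) ∧ P (c • (e K s i * x K s)) ∧
      P (c • (e K s i * y K s)) ∧ P (c • (e K s i * x K s * y K s))) (z : Lam K s) : P z := by
  have hz : z ∈ ⨆ i, rowSpan K s i := by rw [iSup_rowSpan]; trivial
  refine Submodule.iSup_induction _ (motive := P) hz ?_ zero add
  intro i w hw
  refine Submodule.closure_induction (p := fun w _ => P w) zero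
    (fun _ _ _ _ => add _ _) ?_ hw
  rintro c w (rfl | rfl | rfl | rfl)
  exacts [(basis c i).1, (basis c i).2.1, (basis c i).2.2.1, (basis c i).2.2.2]

/-- The expansion of an element of `Λ` in the standard basis. -/
theorem lam_expand (z : Lam K s) :
    z = ∑ i, (coeffE K s i z • e K s i + coeffX K s i z • (e K s i * x K s) +
      coeffY K s i z • (e K s i * y K s) + coeffXY K s i z • (e K s i * x K s * y K s)) := by
  induction z using lam_induction with
  | zero => simp
  | add z w hz hw =>
    conv_lhs => rw [hz, hw]
    rw [← Finset.sum_add_distrib]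
    refine Finset.sum_congr rfl fun i _ => ?_
    simp only [map_add, add_smul]
    abel
  | basis c k =>
    simp only [map_smul, coeffE_e, coeffE_e_x, coeffE_e_y, coeffE_e_x_y, coeffX_e, coeffX_e_x,
      coeffX_e_y, coeffX_e_x_y, coeffY_e, coeffY_e_x, coeffY_e_y, coeffY_e_x_y, coeffXY_e,
      coeffXY_e_x, coeffXY_e_y, coeffXY_e_x_y, smul_eq_mul, mul_ite, mul_one, mul_zero, ite_smul,
      zero_smul, add_zero, zero_add, Finset.sum_ite_eq, Finset.mem_univ, if_true, and_self]


/-! ### Left and right multiplication on bimodules -/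

theorem EnvAlg_smul_mk (r : K) (a c : Lam K s) :
    EnvAlg.mk K (r • a) c = algebraMap K (Env K s) r * EnvAlg.mk K a c := by
  rw [← Algebra.smul_def]
  exact (TensorProduct.smul_tmul' r a (op c)).symm

theorem EnvAlg_mk_smul (r : K) (a c : Lam K s) :
    EnvAlg.mk K a (r • c) = algebraMap K (Env K s) r * EnvAlg.mk K a c := by
  rw [← Algebra.smul_def]
  exact TensorProduct.tmul_smul r a (op c)

theorem onLeft_smul (r : K) (a : Lam K s) :
    onLeft (r • a) = algebraMap K (Env K s) r * onLeft a := EnvAlg_smul_mk K s r a 1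

theorem onRight_smul (r : K) (a : Lam K s) :
    onRight (r • a) = algebraMap K (Env K s) r * onRight a := EnvAlg_mk_smul K s r 1 a

theorem onLeft_one : (onLeft 1 : Env K s) = 1 := rfl

theorem onRight_one : (onRight 1 : Env K s) = 1 := rfl

theorem mk_eq_onLeft_mul_onRight (a c : Lam K s) :
    EnvAlg.mk K a c = onLeft a * onRight c := by
  rw [onLeft, onRight, EnvAlg.mk_mul_mk, mul_one, mul_one]

theorem onRight_neg (a : Lam K s) : (onRight (-a) : Env K s) = -onRight a := by
  rw [eq_neg_iff_add_eq_zero, ← onRight_add, neg_add_cancel, onRight_zero]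

theorem env_induction {P : Env K s → Prop} (zero : P 0) (add : ∀ c d, P c → P d → P (c + d))
    (mk : ∀ a c : Lam K s, P (EnvAlg.mk K a c)) (c : Env K s) : P c :=
  TensorProduct.induction_on (motive := P) c zero (fun a c => mk a c.unop) add

section action

variable {M : Type u} [AddCommGroup M] [Module (Env K s) M]

theorem onLeft_onLeft_smul (a c : Lam K s) (q : M) :
    (onLeft a : Env K s) • (onLeft c : Env K s) • q = (onLeft (a * c) : Env K s) • q := by
  rw [← mul_smul, onLeft_mul]

theorem onRight_onRight_smul (a c : Lam K s) (q : M) :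
    (onRight a : Env K s) • (onRight c : Env K s) • q = (onRight (c * a) : Env K s) • q := by
  rw [← mul_smul, onRight_mul]

theorem onRight_onLeft_smul (a c : Lam K s) (q : M) :
    (onRight a : Env K s) • (onLeft c : Env K s) • q =
      (onLeft c : Env K s) • (onRight a : Env K s) • q := by
  rw [← mul_smul, ← mul_smul, onLeft_onRight]

theorem smul_algebraMap_smul (a : Env K s) (r : K) (q : M) :
    a • algebraMap K (Env K s) r • q = algebraMap K (Env K s) r • a • q := by
  rw [← mul_smul, ← mul_smul, Algebra.commutes]

end action

theorem onLeft_e_gen (n : ℕ) (i : ZMod s) (j : ℤ) :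
    (onLeft (e K s i) : Env K s) • gen K s n i j = gen K s n i j := by
  rw [← ee_gen K s n i j _ rfl, ← mul_smul]
  congr 1
  rw [onLeft, ee, EnvAlg.mk_mul_mk, e_mul_e, mul_one]

theorem onRight_e_gen (n : ℕ) (i : ZMod s) (j : ℤ) (l : ZMod s) :
    (onRight (e K s l) : Env K s) • gen K s n i j =
      if l = i + (n : ZMod s) then gen K s n i j else 0 := by
  conv_lhs => rw [← ee_gen K s n i j _ rfl, ← mul_smul]
  rw [onRight, ee, EnvAlg.mk_mul_mk, e_mul_e_eq_ite, one_mul]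
  split_ifs with h h' h'
  · rw [h, ← ee, ee_gen K s n i j _ h']
  · exact absurd h.symm h'
  · exact absurd h'.symm h
  · rw [EnvAlg.mk_zero, zero_smul]

/-- The generators, multiplied from the left by arbitrary elements and from the right by one of
`1`, `x`, `y`, `xy`, span the bimodule `Qⁿ` additively. -/
theorem Q_induction {n : ℕ} {P : Q K s n → Prop} (zero : P 0)
    (add : ∀ p q, P p → P q → P (p + q))
    (gen : ∀ (a v : Lam K s) (i : ZMod s) (j : Fin (n + 1)),
      (v = 1 ∨ v = x K s ∨ v = y K s ∨ v = x K s * y K s) →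
      P ((onLeft a : Env K s) • (onRight v : Env K s) • gen K s n i (j : ℕ))) (q : Q K s n) :
    P q := by
  have key : ∀ (a : Lam K s) (i : ZMod s) (j : Fin (n + 1)) (c : Lam K s),
      P ((onLeft a : Env K s) • (onRight c : Env K s) • CircAlg.gen K s n i (j : ℕ)) := by
    intro a i j c
    have hv : ∀ (v : Lam K s), (v = 1 ∨ v = x K s ∨ v = y K s ∨ v = x K s * y K s) →
        ∀ (r : K) (l : ZMod s), P ((onLeft a : Env K s) • (onRight (r • (e K s l * v)) : Env K s) •
          CircAlg.gen K s n i (j : ℕ)) := by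
      intro v hv r l
      rw [onRight_smul, ← onRight_mul, mul_smul, mul_smul, onRight_e_gen, smul_algebraMap_smul,
        ← mul_smul, ← onLeft_smul]
      split_ifs
      · exact gen _ v i j hv
      · simpa only [smul_zero] using zero
    induction c using lam_induction with
    | zero => simpa only [onRight_zero, zero_smul, smul_zero] using zero
    | add z w hz hw =>
      rw [onRight_add, add_smul, smul_add]
      exact add _ _ hz hw
    | basis r l =>
      refine ⟨?_, hv _ (.inr (.inl rfl)) r l, hv _ (.inr (.inr (.inl rfl))) r l, ?_⟩
      · simpa only [mul_one] using hv 1 (.inl rfl) r l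
      · simpa only [mul_assoc] using hv _ (.inr (.inr (.inr rfl))) r l
  induction q using DirectSum.induction_on with
  | zero => exact zero
  | add p q hp hq => exact add p q hp hq
  | of p z =>
    obtain ⟨i, j⟩ := p
    obtain ⟨c, rfl⟩ := exists_smul_cornerGen K s z
    have hgen : QIncl K s n i j (cornerGen K s i (i + (n : ZMod s))) =
        CircAlg.gen K s n i (j : ℕ) := by
      rw [CircAlg.gen, dif_pos (by omega)]
      rfl
    change P (QIncl K s n i j (c • cornerGen K s i (i + (n : ZMod s))))
    rw [map_smul, hgen]
    induction c using env_induction with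
    | zero => simpa only [zero_smul] using zero
    | add c d hc hd =>
      rw [add_smul]
      exact add _ _ hc hd
    | mk a c =>
      rw [mk_eq_onLeft_mul_onRight, mul_smul]
      exact key a i j c

/-! ### The contracting homotopy -/

/-- The value of the homotopy on `b i j c`, as a function of `c`: on the basis of
`e (i + n) Λ` it sends `x` to `b i (j+1)`, `xy` to `b i (j+1) y`, and `y` to `b i 0` if `j = 0`,
while the remaining basis elements go to `0`. -/
def homotopyVal (n : ℕ) (i : ZMod s) (j : ℤ) : Lam K s →+ Q K s (n + 1) :=
  AddMonoidHom.mk' (fun c =>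
    algebraMap K (Env K s) (coeffX K s (i + n) c) • gen K s (n + 1) i (j + 1) +
    algebraMap K (Env K s) (coeffY K s (i + n) c) • (if j = 0 then gen K s (n + 1) i 0 else 0) +
    algebraMap K (Env K s) (coeffXY K s (i + n) c) •
      (onRight (y K s) : Env K s) • gen K s (n + 1) i (j + 1)) fun c d => by
    simp only [map_add, add_smul]
    abel

theorem homotopyVal_apply (n : ℕ) (i : ZMod s) (j : ℤ) (c : Lam K s) :
    homotopyVal K s n i j c =
    algebraMap K (Env K s) (coeffX K s (i + n) c) • gen K s (n + 1) i (j + 1) +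
    algebraMap K (Env K s) (coeffY K s (i + n) c) • (if j = 0 then gen K s (n + 1) i 0 else 0) +
    algebraMap K (Env K s) (coeffXY K s (i + n) c) •
      (onRight (y K s) : Env K s) • gen K s (n + 1) i (j + 1) := rfl

theorem homotopyVal_smul (n : ℕ) (i : ZMod s) (j : ℤ) (r : K) (c : Lam K s) :
    homotopyVal K s n i j (r • c) = algebraMap K (Env K s) r • homotopyVal K s n i j c := by
  simp only [homotopyVal_apply, map_smul, smul_eq_mul, map_mul, mul_smul, smul_add]

theorem homotopyVal_e_mul (n : ℕ) (i : ZMod s) (j : ℤ) (c : Lam K s) :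
    homotopyVal K s n i j (e K s (i + n) * c) = homotopyVal K s n i j c := by
  simp only [homotopyVal_apply, coeffX_apply, coeffY_apply, coeffXY_apply, repr_e_mul_apply]

theorem onLeft_e_homotopyVal (n : ℕ) (i : ZMod s) (j : ℤ) (c : Lam K s) :
    (onLeft (e K s i) : Env K s) • homotopyVal K s n i j c = homotopyVal K s n i j c := by
  simp only [homotopyVal_apply, smul_add, smul_algebraMap_smul, ← onRight_onLeft_smul,
    onLeft_e_gen, smul_ite, smul_zero]

/-- The left linear extension of `homotopyVal` to the free bimodule of rank one. -/
def homotopyEnv (n : ℕ) (i : ZMod s) (j : ℤ) : Env K s →+ Q K s (n + 1) :=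
  TensorProduct.liftAddHom
    (AddMonoidHom.mk' (fun a => AddMonoidHom.mk'
      (fun c : (Lam K s)ᵐᵒᵖ => (onLeft a : Env K s) • homotopyVal K s n i j c.unop)
      fun c d => by
        change (onLeft a : Env K s) • homotopyVal K s n i j (c.unop + d.unop) = _
        rw [map_add, smul_add])
      fun a b => by
        refine AddMonoidHom.ext fun c => ?_
        change (onLeft (a + b) : Env K s) • homotopyVal K s n i j c.unop =
          (onLeft a : Env K s) • homotopyVal K s n i j c.unop +
            (onLeft b : Env K s) • homotopyVal K s n i j c.unop
        rw [onLeft_add, add_smul])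
    fun r a c => by
      change (onLeft (r • a) : Env K s) • homotopyVal K s n i j c.unop =
        (onLeft a : Env K s) • homotopyVal K s n i j (r • c.unop)
      rw [homotopyVal_smul, smul_algebraMap_smul, onLeft_smul, mul_smul]

theorem homotopyEnv_mk (n : ℕ) (i : ZMod s) (j : ℤ) (a c : Lam K s) :
    homotopyEnv K s n i j (EnvAlg.mk K a c) =
      (onLeft a : Env K s) • homotopyVal K s n i j c := rfl

/-- A homotopy on the complex of bimodules that is compatible with the left action. It contracts
the complex up to terms in the left radical. -/
def homotopy (n : ℕ) : Q K s n →+ Q K s (n + 1) :=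
  DirectSum.toAddMonoid fun p : ZMod s × Fin (n + 1) =>
    (homotopyEnv K s n p.1 (p.2 : ℕ)).comp (cornerIncl K s p.1 (p.1 + n)).toAddMonoidHom

theorem homotopy_onLeft_onRight_gen (n : ℕ) (i : ZMod s) (j : Fin (n + 1)) (a c : Lam K s) :
    homotopy K s n ((onLeft a : Env K s) • (onRight c : Env K s) • gen K s n i (j : ℕ)) =
      (onLeft a : Env K s) • homotopyVal K s n i (j : ℕ) c := by
  rw [gen, dif_pos (by omega), ← mul_smul, ← map_smul]
  refine (DirectSum.toAddMonoid_of _ _ _).trans ?_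
  change homotopyEnv K s n i (j : ℕ) (onLeft a * onRight c * ee K s i (i + n)) = _
  rw [← mk_eq_onLeft_mul_onRight, ee, EnvAlg.mk_mul_mk, homotopyEnv_mk, ← onLeft_mul, mul_smul,
    onLeft_e_homotopyVal, homotopyVal_e_mul]

theorem homotopy_onLeft (n : ℕ) (a : Lam K s) (q : Q K s n) :
    homotopy K s n ((onLeft a : Env K s) • q) = (onLeft a : Env K s) • homotopy K s n q := by
  induction q using Q_induction with
  | zero => simp only [smul_zero, map_zero]
  | add p q hp hq => simp only [smul_add, map_add, hp, hq]
  | gen b v i j hv => rw [onLeft_onLeft_smul, homotopy_onLeft_onRight_gen, homotopy_onLeft_onRight_gen, onLeft_onLeft_smul]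

theorem homotopy_onRight_gen (n : ℕ) (i : ZMod s) (j : Fin (n + 1)) (c : Lam K s) :
    homotopy K s n ((onRight c : Env K s) • gen K s n i (j : ℕ)) =
      homotopyVal K s n i (j : ℕ) c := by
  have h := homotopy_onLeft_onRight_gen K s n i j 1 c
  rwa [onLeft_one, one_smul, one_smul] at h

theorem homotopyVal_one (n : ℕ) (i : ZMod s) (j : ℤ) : homotopyVal K s n i j 1 = 0 := by
  rw [← homotopyVal_e_mul, mul_one, homotopyVal_apply, coeffX_e, coeffY_e, coeffXY_e]
  simp only [map_zero, zero_smul, add_zero]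

theorem homotopyVal_x (n : ℕ) (i : ZMod s) (j : ℤ) :
    homotopyVal K s n i j (x K s) = gen K s (n + 1) i (j + 1) := by
  rw [← homotopyVal_e_mul, homotopyVal_apply, coeffX_e_x, coeffY_e_x, coeffXY_e_x, if_pos rfl]
  simp only [map_zero, zero_smul, add_zero, map_one, one_smul]

theorem homotopyVal_y (n : ℕ) (i : ZMod s) (j : ℤ) :
    homotopyVal K s n i j (y K s) = if j = 0 then gen K s (n + 1) i 0 else 0 := by
  rw [← homotopyVal_e_mul, homotopyVal_apply, coeffX_e_y, coeffY_e_y, coeffXY_e_y, if_pos rfl]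
  simp only [map_zero, zero_smul, add_zero, zero_add, map_one, one_smul]

theorem homotopyVal_x_mul_y (n : ℕ) (i : ZMod s) (j : ℤ) :
    homotopyVal K s n i j (x K s * y K s) =
      (onRight (y K s) : Env K s) • gen K s (n + 1) i (j + 1) := by
  rw [← homotopyVal_e_mul, ← mul_assoc, homotopyVal_apply, coeffX_e_x_y, coeffY_e_x_y,
    coeffXY_e_x_y, if_pos rfl]
  simp only [map_zero, zero_smul, zero_add, map_one, one_smul]

theorem exists_eq_fin {n : ℕ} {j : ℤ} (h : 0 ≤ j ∧ j ≤ n) : ∃ l : Fin (n + 1), ((l : ℕ) : ℤ) = j :=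
  ⟨⟨j.toNat, by omega⟩, by simp only []; omega⟩

theorem homotopy_gen (n : ℕ) (i : ZMod s) (j : ℤ) : homotopy K s n (gen K s n i j) = 0 := by
  by_cases h : 0 ≤ j ∧ j ≤ n
  · obtain ⟨l, rfl⟩ := exists_eq_fin h
    have := homotopy_onRight_gen K s n i l 1
    rwa [onRight_one, one_smul, homotopyVal_one] at this
  · rw [gen_of_not K s h, map_zero]

theorem homotopy_x_gen (n : ℕ) (i : ZMod s) {j : ℤ} (hj : 0 ≤ j) :
    homotopy K s n ((onRight (x K s) : Env K s) • gen K s n i j) = gen K s (n + 1) i (j + 1) := by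
  by_cases h : j ≤ n
  · obtain ⟨l, rfl⟩ := exists_eq_fin ⟨hj, h⟩
    rw [homotopy_onRight_gen, homotopyVal_x]
  · rw [gen_of_not K s (by omega), gen_of_not K s (by omega), smul_zero, map_zero]

theorem homotopy_y_gen (n : ℕ) (i : ZMod s) (j : ℤ) :
    homotopy K s n ((onRight (y K s) : Env K s) • gen K s n i j) =
      if j = 0 then gen K s (n + 1) i 0 else 0 := by
  by_cases h : 0 ≤ j ∧ j ≤ n
  · obtain ⟨l, rfl⟩ := exists_eq_fin h
    rw [homotopy_onRight_gen, homotopyVal_y]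
  · rw [gen_of_not K s (by omega), if_neg (by omega), smul_zero, map_zero]

theorem homotopy_x_mul_y_gen (n : ℕ) (i : ZMod s) {j : ℤ} (hj : 0 ≤ j) :
    homotopy K s n ((onRight (x K s * y K s) : Env K s) • gen K s n i j) =
      (onRight (y K s) : Env K s) • gen K s (n + 1) i (j + 1) := by
  by_cases h : j ≤ n
  · obtain ⟨l, rfl⟩ := exists_eq_fin ⟨hj, h⟩
    rw [homotopy_onRight_gen, homotopyVal_x_mul_y]
  · rw [gen_of_not K s (by omega), gen_of_not K s (by omega), smul_zero, smul_zero, map_zero]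

/-! ### Exactness -/

theorem exists_mul_eq_x_mul (a : Lam K s) : ∃ c, a * x K s = x K s * c := by
  induction a using lam_induction with
  | zero => exact ⟨0, by rw [zero_mul, mul_zero]⟩
  | add z w hz hw =>
    obtain ⟨c, hc⟩ := hz
    obtain ⟨d, hd⟩ := hw
    exact ⟨c + d, by rw [add_mul, mul_add, hc, hd]⟩
  | basis r i =>
    refine ⟨⟨r • e K s (i + 1), ?_⟩, ⟨0, ?_⟩, ⟨-(r • (e K s (i + 1) * y K s)), ?_⟩, ⟨0, ?_⟩⟩
    · rw [smul_mul_assoc, e_mul_x, mul_smul_comm]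
    · rw [smul_mul_assoc, mul_assoc, x_mul_x, mul_zero, smul_zero, mul_zero]
    · rw [smul_mul_assoc, mul_assoc, y_mul_x, mul_neg, smul_neg, mul_neg, mul_smul_comm,
        ← mul_assoc, ← mul_assoc, e_mul_x]
    · rw [smul_mul_assoc, mul_assoc, y_mul_x, mul_neg, mul_assoc, ← mul_assoc (x K s), x_mul_x,
        zero_mul, mul_zero, neg_zero, smul_zero, mul_zero]

theorem exists_mul_eq_y_mul (a : Lam K s) : ∃ c, a * y K s = y K s * c := by
  induction a using lam_induction with
  | zero => exact ⟨0, by rw [zero_mul, mul_zero]⟩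
  | add z w hz hw =>
    obtain ⟨c, hc⟩ := hz
    obtain ⟨d, hd⟩ := hw
    exact ⟨c + d, by rw [add_mul, mul_add, hc, hd]⟩
  | basis r i =>
    refine ⟨⟨r • e K s (i + 1), ?_⟩, ⟨-(r • (e K s (i + 1) * x K s)), ?_⟩, ⟨0, ?_⟩, ⟨0, ?_⟩⟩
    · rw [smul_mul_assoc, e_mul_y, mul_smul_comm]
    · rw [smul_mul_assoc, mul_assoc, ← neg_neg (x K s * y K s), ← y_mul_x, mul_neg, smul_neg,
        mul_neg, mul_smul_comm, ← mul_assoc, ← mul_assoc, e_mul_y]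
    · rw [smul_mul_assoc, mul_assoc, y_mul_y, mul_zero, smul_zero, mul_zero]
    · rw [smul_mul_assoc, mul_assoc, y_mul_y, mul_zero, smul_zero, mul_zero]

/-- The subgroup `xM + yM` of a bimodule `M`, which is the product of the radical with `M`. -/
def leftRad (M : Type u) [AddCommGroup M] [Module (Env K s) M] : AddSubgroup M :=
  (DistribSMul.toAddMonoidHom M (onLeft (x K s) : Env K s)).range ⊔
    (DistribSMul.toAddMonoidHom M (onLeft (y K s) : Env K s)).range

section leftRad

variable {K s} {M : Type u} [AddCommGroup M] [Module (Env K s) M]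

theorem mem_leftRad_iff {q : M} : q ∈ leftRad K s M ↔
    ∃ q₁ q₂ : M, q = (onLeft (x K s) : Env K s) • q₁ + (onLeft (y K s) : Env K s) • q₂ := by
  rw [leftRad, AddSubgroup.mem_sup]
  constructor
  · rintro ⟨_, ⟨q₁, rfl⟩, _, ⟨q₂, rfl⟩, rfl⟩
    exact ⟨q₁, q₂, rfl⟩
  · rintro ⟨q₁, q₂, rfl⟩
    exact ⟨_, ⟨q₁, rfl⟩, _, ⟨q₂, rfl⟩, rfl⟩

theorem onLeft_x_smul_mem (q : M) : (onLeft (x K s) : Env K s) • q ∈ leftRad K s M :=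
  mem_leftRad_iff.2 ⟨q, 0, by rw [smul_zero, add_zero]⟩

theorem onLeft_y_smul_mem (q : M) : (onLeft (y K s) : Env K s) • q ∈ leftRad K s M :=
  mem_leftRad_iff.2 ⟨0, q, by rw [smul_zero, zero_add]⟩

theorem onLeft_smul_mem_leftRad (a : Lam K s) {q : M} (hq : q ∈ leftRad K s M) :
    (onLeft a : Env K s) • q ∈ leftRad K s M := by
  obtain ⟨q₁, q₂, rfl⟩ := mem_leftRad_iff.1 hq
  obtain ⟨c, hc⟩ := exists_mul_eq_x_mul K s a
  obtain ⟨d, hd⟩ := exists_mul_eq_y_mul K s a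
  rw [smul_add, onLeft_onLeft_smul, onLeft_onLeft_smul, hc, hd, ← onLeft_onLeft_smul,
    ← onLeft_onLeft_smul]
  exact add_mem (onLeft_x_smul_mem _) (onLeft_y_smul_mem _)

theorem onRight_smul_mem_leftRad (a : Lam K s) {q : M} (hq : q ∈ leftRad K s M) :
    (onRight a : Env K s) • q ∈ leftRad K s M := by
  obtain ⟨q₁, q₂, rfl⟩ := mem_leftRad_iff.1 hq
  rw [smul_add, onRight_onLeft_smul, onRight_onLeft_smul]
  exact add_mem (onLeft_x_smul_mem _) (onLeft_y_smul_mem _)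

theorem map_mem_leftRad {N : Type u} [AddCommGroup N] [Module (Env K s) N] (f : M →+ N)
    (hf : ∀ (a : Lam K s) (q : M), f ((onLeft a : Env K s) • q) = (onLeft a : Env K s) • f q)
    {q : M} (hq : q ∈ leftRad K s M) : f q ∈ leftRad K s N := by
  obtain ⟨q₁, q₂, rfl⟩ := mem_leftRad_iff.1 hq
  rw [map_add, hf, hf]
  exact add_mem (onLeft_x_smul_mem _) (onLeft_y_smul_mem _)

/-- A left linear map into the left radical is nilpotent, since the cube of the radical of `Λ`
is zero. -/
theorem cube_eq_zero (D : M →+ M)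
    (hD : ∀ (a : Lam K s) (q : M), D ((onLeft a : Env K s) • q) = (onLeft a : Env K s) • D q)
    (hmem : ∀ q, D q ∈ leftRad K s M) (q : M) : D (D (D q)) = 0 := by
  have two : ∀ q, ∃ r : M, D (D q) = (onLeft (x K s * y K s) : Env K s) • r := by
    intro q
    obtain ⟨q₁, q₂, hq⟩ := mem_leftRad_iff.1 (hmem q)
    obtain ⟨r₁, r₂, hr⟩ := mem_leftRad_iff.1 (hmem q₁)
    obtain ⟨t₁, t₂, ht⟩ := mem_leftRad_iff.1 (hmem q₂)
    have hn : (onLeft (-(x K s * y K s)) : Env K s) = -onLeft (x K s * y K s) := by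
      rw [eq_neg_iff_add_eq_zero, ← onLeft_add, neg_add_cancel, onLeft_zero]
    refine ⟨r₂ - t₁, ?_⟩
    rw [hq, map_add, hD, hD, hr, ht]
    simp only [smul_add, onLeft_onLeft_smul, x_mul_x, y_mul_y, y_mul_x, onLeft_zero, zero_smul,
      zero_add, add_zero, hn, neg_smul, smul_neg, sub_eq_add_neg]
  obtain ⟨r, hr⟩ := two q
  obtain ⟨r₁, r₂, hr'⟩ := mem_leftRad_iff.1 (hmem r)
  have h1 : x K s * y K s * x K s = 0 := by
    rw [mul_assoc, y_mul_x, mul_neg, ← mul_assoc, x_mul_x, zero_mul, neg_zero]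
  have h2 : x K s * y K s * y K s = 0 := by
    rw [mul_assoc, y_mul_y, mul_zero]
  rw [hr, hD, hr', smul_add, onLeft_onLeft_smul, onLeft_onLeft_smul, h1, h2, onLeft_zero,
    zero_smul, zero_smul, add_zero]

end leftRad

/-- Up to the left radical, only the part of the differential that involves the right action
remains. -/
theorem bd_gen_sub_mem (n : ℕ) (i : ZMod s) (j : ℤ) :
    bd K s n (gen K s (n + 1) i j) - ((onRight (x K s) : Env K s) • gen K s n i (j - 1) +
      (onRight (y K s) : Env K s) • gen K s n i j) ∈ leftRad K s (Q K s n) := by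
  rw [bd_gen, bdGen, add_sub_cancel_left]
  exact zsmul_mem (add_mem (onLeft_y_smul_mem _) (onLeft_x_smul_mem _)) _

theorem homotopy_bd_onRight_gen_sub_mem (n : ℕ) (i : ZMod s) (j : ℤ) (v : Lam K s) :
    homotopy K s n (bd K s n ((onRight v : Env K s) • gen K s (n + 1) i j)) -
      (homotopy K s n ((onRight (x K s * v) : Env K s) • gen K s n i (j - 1)) +
        homotopy K s n ((onRight (y K s * v) : Env K s) • gen K s n i j)) ∈
      leftRad K s (Q K s (n + 1)) := by
  have h := map_mem_leftRad (homotopy K s n) (homotopy_onLeft K s n)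
    (onRight_smul_mem_leftRad v (bd_gen_sub_mem K s n i j))
  rwa [smul_sub, ← map_smul, map_sub, smul_add, onRight_onRight_smul, onRight_onRight_smul,
    map_add] at h

theorem y_x_y : y K s * (x K s * y K s) = 0 := by
  rw [← mul_assoc, y_mul_x, neg_mul, mul_assoc, y_mul_y, mul_zero, neg_zero]

theorem x_x_y : x K s * (x K s * y K s) = 0 := by
  rw [← mul_assoc, x_mul_x, zero_mul]

/-- The value of `d h` on the right multiples of the generators, up to the left radical. -/
theorem bd_homotopy_mem (n : ℕ) (i : ZMod s) {j : ℤ} (hj : 0 ≤ j) :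
    bd K s n (homotopy K s n ((onRight (x K s) : Env K s) • gen K s n i j)) -
      ((onRight (x K s) : Env K s) • gen K s n i j +
        (onRight (y K s) : Env K s) • gen K s n i (j + 1)) ∈ leftRad K s (Q K s n) ∧
    bd K s n (homotopy K s n ((onRight (y K s) : Env K s) • gen K s n i j)) -
      (if j = 0 then (onRight (y K s) : Env K s) • gen K s n i 0 else 0) ∈
        leftRad K s (Q K s n) ∧
    bd K s n (homotopy K s n ((onRight (x K s * y K s) : Env K s) • gen K s n i j)) -
      (onRight (x K s * y K s) : Env K s) • gen K s n i j ∈ leftRad K s (Q K s n) := by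
  refine ⟨?_, ?_, ?_⟩
  · rw [homotopy_x_gen K s n i hj]
    have h := bd_gen_sub_mem K s n i (j + 1)
    rwa [add_sub_cancel_right] at h
  · rw [homotopy_y_gen K s n i]
    split_ifs
    · have h := bd_gen_sub_mem K s n i 0
      rwa [gen_of_not K s (j := 0 - 1) (by omega), smul_zero, zero_add] at h
    · rw [map_zero, sub_zero]
      exact zero_mem _
  · rw [homotopy_x_mul_y_gen K s n i hj, map_smul]
    have h := onRight_smul_mem_leftRad (y K s) (bd_gen_sub_mem K s n i (j + 1))
    rwa [add_sub_cancel_right, smul_sub, smul_add, onRight_onRight_smul, onRight_onRight_smul,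
      y_mul_y, onRight_zero, zero_smul, add_zero] at h

/-- The defect `d h + h d - 1` of the homotopy in positive degree. -/
def defect (n : ℕ) : Q K s (n + 1) →+ Q K s (n + 1) :=
  (bd K s (n + 1)).toAddMonoidHom.comp (homotopy K s (n + 1)) +
    (homotopy K s n).comp (bd K s n).toAddMonoidHom - AddMonoidHom.id _

theorem defect_apply (n : ℕ) (q : Q K s (n + 1)) :
    defect K s n q = bd K s (n + 1) (homotopy K s (n + 1) q) + homotopy K s n (bd K s n q) - q :=
  rfl

theorem defect_onLeft (n : ℕ) (a : Lam K s) (q : Q K s (n + 1)) :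
    defect K s n ((onLeft a : Env K s) • q) = (onLeft a : Env K s) • defect K s n q := by
  simp only [defect_apply, homotopy_onLeft, map_smul, smul_sub, smul_add]

theorem add_sub_mem_of_sub_mem {A : Type*} [AddCommGroup A] (S : AddSubgroup A) {a b a' b' c : A}
    (ha : a - a' ∈ S) (hb : b - b' ∈ S) (hc : a' + b' = c) : a + b - c ∈ S := by
  have h := add_mem ha hb
  rw [← hc]
  convert h using 1
  abel

/-- On right multiples of the generators and up to the left radical, `homotopy` contracts the
Koszul complex of right modules; both `dh` and `hd` are left linear, so that this suffices. -/
theorem defect_mem (n : ℕ) (q : Q K s (n + 1)) : defect K s n q ∈ leftRad K s (Q K s (n + 1)) := by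
  induction q using Q_induction with
  | zero => rw [map_zero]; exact zero_mem _
  | add p q hp hq => rw [map_add]; exact add_mem hp hq
  | gen a v i j hv =>
    rw [defect_onLeft]
    refine onLeft_smul_mem_leftRad a ?_
    have hj : (0 : ℤ) ≤ (j : ℕ) := by omega
    have hd := homotopy_bd_onRight_gen_sub_mem K s n i (j : ℕ) v
    have hh := bd_homotopy_mem K s (n + 1) i hj
    rw [defect_apply]
    rcases hv with rfl | rfl | rfl | rfl
    · refine add_sub_mem_of_sub_mem _ (a' := 0) ?_ hd ?_
      · rw [onRight_one, one_smul, homotopy_gen, map_zero, sub_zero]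
        exact zero_mem _
      · rw [mul_one, mul_one, onRight_one, one_smul, homotopy_y_gen, zero_add]
        split_ifs with h
        · rw [h, gen_of_not K s (by omega), smul_zero, map_zero, zero_add]
        · rw [homotopy_x_gen K s n i (by omega), sub_add_cancel, add_zero]
    · refine add_sub_mem_of_sub_mem _ hh.1 hd ?_
      rw [x_mul_x, onRight_zero, zero_smul, map_zero, zero_add, y_mul_x, onRight_neg, neg_smul,
        map_neg, homotopy_x_mul_y_gen K s n i hj, add_neg_cancel_right]
    · refine add_sub_mem_of_sub_mem _ hh.2.1 hd ?_
      rw [y_mul_y, onRight_zero, zero_smul, map_zero, add_zero]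
      split_ifs with h
      · rw [h, gen_of_not K s (j := 0 - 1) (by omega), smul_zero, map_zero, add_zero]
      · rw [homotopy_x_mul_y_gen K s n i (by omega), sub_add_cancel, zero_add]
    · refine add_sub_mem_of_sub_mem _ hh.2.2 hd ?_
      rw [x_x_y, y_x_y, onRight_zero, zero_smul, zero_smul, map_zero, add_zero, add_zero]

/-- The defect `d h + h ∂⁰ - 1` of the homotopy in degree zero, where the section of the
augmentation `∂⁰` sends `a` to `∑ i, a b i 0`. -/
def defectZero : Q K s 0 →+ Q K s 0 :=
  (bd K s 0).toAddMonoidHom.comp (homotopy K s 0) +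
    AddMonoidHom.mk' (fun q => (onLeft (multMap K s q) : Env K s) • ∑ i, gen K s 0 i 0)
      (fun p q => by rw [map_add, onLeft_add, add_smul]) - AddMonoidHom.id _

theorem defectZero_apply (q : Q K s 0) :
    defectZero K s q = bd K s 0 (homotopy K s 0 q) +
      (onLeft (multMap K s q) : Env K s) • ∑ i, gen K s 0 i 0 - q := rfl

theorem onLeft_smul_lam (a z : Lam K s) : (onLeft a : Env K s) • z = a * z := by
  rw [onLeft, EnvAlg.mk_smul, mul_one]

theorem onRight_smul_lam (a z : Lam K s) : (onRight a : Env K s) • z = z * a := by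
  rw [onRight, EnvAlg.mk_smul, one_mul]

theorem multMap_gen (i : ZMod s) : multMap K s (gen K s 0 i 0) = e K s i := by
  refine (homOfGen_gen (K := K) (s := s) 0 (fun _ _ => (1 : Lam K s)) i 0).trans ?_
  rw [ee, EnvAlg.mk_smul, mul_one, Nat.cast_zero, add_zero, e_mul_e]

theorem defectZero_onLeft (a : Lam K s) (q : Q K s 0) :
    defectZero K s ((onLeft a : Env K s) • q) = (onLeft a : Env K s) • defectZero K s q := by
  simp only [defectZero_apply, homotopy_onLeft, map_smul, smul_sub, smul_add, onLeft_smul_lam,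
    onLeft_onLeft_smul]

theorem onLeft_e_sum_gen (i : ZMod s) :
    (onLeft (e K s i) : Env K s) • ∑ k, gen K s 0 k 0 = gen K s 0 i 0 := by
  rw [Finset.smul_sum, Finset.sum_eq_single i, onLeft_e_gen]
  · intro k _ hk
    rw [← onLeft_e_gen, onLeft_onLeft_smul, e_mul_e_of_ne K s hk.symm, onLeft_zero, zero_smul]
  · exact fun h => absurd (Finset.mem_univ _) h

theorem defectZero_mem (q : Q K s 0) : defectZero K s q ∈ leftRad K s (Q K s 0) := by
  induction q using Q_induction with
  | zero => rw [map_zero]; exact zero_mem _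
  | add p q hp hq => rw [map_add]; exact add_mem hp hq
  | gen a v i j hv =>
    rw [defectZero_onLeft]
    refine onLeft_smul_mem_leftRad a ?_
    obtain rfl : j = 0 := Fin.ext (by omega)
    have hh := bd_homotopy_mem K s 0 i le_rfl
    have h0 : (((0 : Fin (0 + 1)) : ℕ) : ℤ) = 0 := rfl
    rw [h0, defectZero_apply, map_smul (multMap K s), multMap_gen, onRight_smul_lam]
    rcases hv with rfl | rfl | rfl | rfl
    · rw [onRight_one, one_smul, homotopy_gen, map_zero, zero_add, mul_one,
        onLeft_e_sum_gen, sub_self]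
      exact zero_mem _
    · refine add_sub_mem_of_sub_mem _ hh.1 (b' := 0) ?_ ?_
      · rw [sub_zero, e_mul_x, ← onLeft_onLeft_smul]
        exact onLeft_x_smul_mem _
      · rw [gen_of_not K s (j := 0 + 1) (by omega), smul_zero, add_zero, add_zero]
    · refine add_sub_mem_of_sub_mem _ hh.2.1 (b' := 0) ?_ ?_
      · rw [sub_zero, e_mul_y, ← onLeft_onLeft_smul]
        exact onLeft_y_smul_mem _
      · rw [if_pos rfl, add_zero]
    · refine add_sub_mem_of_sub_mem _ hh.2.2 (b' := 0) ?_ (add_zero _)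
      rw [sub_zero, ← mul_assoc, e_mul_x, mul_assoc, ← onLeft_onLeft_smul]
      exact onLeft_x_smul_mem _

/-- If `d h` differs from the identity on cycles by a nilpotent operator, then every cycle is a
boundary. -/
theorem exists_bd_eq {A B C : Type*} [AddCommGroup A] [AddCommGroup B] [AddCommGroup C]
    (d : B →+ A) (d' : A →+ C) (hdd : ∀ b, d' (d b) = 0) (h : A →+ B) (D : A →+ A)
    (hD : ∀ z, d' z = 0 → D z = d (h z) - z) (hcube : ∀ z, D (D (D z)) = 0) {z : A}
    (hz : d' z = 0) : ∃ w, d w = z := by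
  have hcyc : ∀ u, d' u = 0 → d' (D u) = 0 := fun u hu => by
    rw [hD u hu, map_sub, hdd, hu, sub_zero]
  have hh : ∀ u, d' u = 0 → d (h u) = u + D u := fun u hu => by
    rw [hD u hu, add_sub_cancel]
  refine ⟨h z - h (D z) + h (D (D z)), ?_⟩
  rw [map_add, map_sub, hh z hz, hh _ (hcyc z hz), hh _ (hcyc _ (hcyc z hz)), hcube]
  abel

/-- Exactness of the complex in positive degrees. -/
theorem exact_bd (n : ℕ) {z : Q K s (n + 1)} (hz : bd K s n z = 0) :
    ∃ w, bd K s (n + 1) w = z :=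
  exists_bd_eq (bd K s (n + 1)).toAddMonoidHom (bd K s n).toAddMonoidHom
    (fun w => LinearMap.congr_fun (bd_comp_bd K s n) w) (homotopy K s (n + 1)) (defect K s n)
    (fun z hz => by
      rw [defect_apply, show bd K s n z = 0 from hz, map_zero, add_zero]
      rfl)
    (cube_eq_zero _ (defect_onLeft K s n) (defect_mem K s n)) hz

/-- Exactness of the augmented complex in degree zero. -/
theorem exact_multMap {z : Q K s 0} (hz : multMap K s z = 0) : ∃ w, bd K s 0 w = z :=
  exists_bd_eq (bd K s 0).toAddMonoidHom (multMap K s).toAddMonoidHom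
    (fun w => LinearMap.congr_fun (multMap_comp_bd K s) w) (homotopy K s 0) (defectZero K s)
    (fun z hz => by
      rw [defectZero_apply, show multMap K s z = 0 from hz, onLeft_zero, zero_smul, add_zero]
      rfl)
    (cube_eq_zero _ (defectZero_onLeft K s) (defectZero_mem K s)) hz

theorem multMap_surjective : Function.Surjective (multMap K s) := fun a =>
  ⟨(onLeft a : Env K s) • ∑ i, gen K s 0 i 0, by
    simp only [map_smul, map_sum, multMap_gen]
    rw [sum_e, onLeft_smul_lam, mul_one]⟩

theorem QAug_f_zero : (QAug K s).f 0 = ModuleCat.ofHom (multMap K s) :=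
  ChainComplex.toSingle₀Equiv_symm_apply_f_zero _ _

/-- The augmented complex is exact, so the `Qⁿ` form a projective resolution of `Λ`. -/
theorem quasiIso_QAug : QuasiIso (QAug K s) := by
  refine ⟨fun n => ?_⟩
  cases n with
  | zero =>
    rw [ChainComplex.quasiIsoAt₀_iff, ShortComplex.quasiIso_iff_of_zeros']
    · constructor
      · rw [ShortComplex.moduleCat_exact_iff]
        intro z hz
        change (ConcreteCategory.hom ((QAug K s).f 0)) z = 0 at hz
        rw [QAug_f_zero] at hz
        obtain ⟨w, hw⟩ := exact_multMap K s (z := z) hz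
        refine ⟨w, ?_⟩
        change (ConcreteCategory.hom ((QComplex K s).d 1 0)) w = z
        rw [QComplex_d]
        exact hw
      · change Epi ((QAug K s).f 0)
        rw [QAug_f_zero]
        exact (ModuleCat.epi_iff_surjective _).2 (multMap_surjective K s)
    all_goals rfl
  | succ n =>
    rw [quasiIsoAt_iff_exactAt' _ _ (ChainComplex.exactAt_succ_single_obj _ _),
      HomologicalComplex.exactAt_iff' _ (n + 2) (n + 1) n (by simp) (by simp),
      ShortComplex.moduleCat_exact_iff]
    intro z hz
    change (ConcreteCategory.hom ((QComplex K s).d (n + 1) n)) z = 0 at hz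
    rw [QComplex_d] at hz
    obtain ⟨w, hw⟩ := exact_bd K s n (z := z) hz
    refine ⟨w, ?_⟩
    change (ConcreteCategory.hom ((QComplex K s).d (n + 2) (n + 1))) w = z
    rw [QComplex_d]
    exact hw
end CircAlg

section ExtClasses

/-! ### Bases of `Ext` from a projective resolution -/

open CategoryTheory Abelian

variable {K : Type u} [Field K] {E : Type u} [Ring E] [Algebra K E] {X Y : ModuleCat.{u} E}

theorem smul_extMk (R : ProjectiveResolution X) {n : ℕ} (f : R.complex.X n ⟶ Y) (m : ℕ)
    (hm : n + 1 = m) (hf : R.complex.d m n ≫ f = 0) (r : K) :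
    r • (R.extMk f m hm hf : Ext.{u} X Y n) =
      R.extMk (r • f) m hm (by rw [Linear.comp_smul, hf, smul_zero]) := by
  rw [Ext.smul_eq_comp_mk₀, ProjectiveResolution.extMk_comp_mk₀]
  congr 1

/-- In degree zero there are no nonzero coboundaries. -/
theorem extMk_eq_zero_iff_of_degree_zero (R : ProjectiveResolution X) (f : R.complex.X 0 ⟶ Y)
    (m : ℕ) (hm : 0 + 1 = m) (hf : R.complex.d m 0 ≫ f = 0) :
    (R.extMk f m hm hf : Ext.{u} X Y 0) = 0 ↔ f = 0 := by
  refine ⟨fun h => ?_, fun h => ?_⟩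
  · rw [← R.extEquivCohomologyClass.apply_eq_iff_eq,
      ProjectiveResolution.extEquivCohomologyClass_extMk,
      ProjectiveResolution.extEquivCohomologyClass_zero,
      CochainComplex.HomComplex.CohomologyClass.mk_eq_zero_iff,
      CochainComplex.HomComplex.Cocycle.toSingleMk_mem_coboundaries_iff _ _ _ _ _ 1 (by lia)] at h
    obtain ⟨g, hg⟩ := h
    have : g = 0 := (R.cochainComplex.isZero_of_isStrictlyLE 0 1).eq_of_src _ _
    rw [this, Limits.comp_zero] at hg
    rw [← cancel_epi (R.cochainComplexXIso (-(0 : ℕ)) 0 rfl).hom, Limits.comp_zero]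
    exact hg.symm
  · subst h; exact R.extMk_zero m hm

/-- A finite family of cocycles represents a basis of `Extⁿ` if its linear combinations represent
all classes, and if only the trivial one of them represents zero. -/
theorem ClassesFormBasis.mk' (R : ProjectiveResolution X) (n : ℕ) {ι : Type} [Fintype ι]
    (f : ι → (R.complex.X n ⟶ Y)) (hf : ∀ t, R.complex.d (n + 1) n ≫ f t = 0)
    (hspan : ∀ g : R.complex.X n ⟶ Y, R.complex.d (n + 1) n ≫ g = 0 → ∃ c : ι → K,
      ∀ h, (R.extMk (g - ∑ t, c t • f t) (n + 1) rfl h : Ext.{u} X Y n) = 0)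
    (hind : ∀ c : ι → K, ∀ h,
      (R.extMk (∑ t, c t • f t) (n + 1) rfl h : Ext.{u} X Y n) = 0 → c = 0) :
    ClassesFormBasis K R n f := by
  have hsum : ∀ c : ι → K, R.complex.d (n + 1) n ≫ (∑ t, c t • f t) = 0 := fun c => by
    rw [Preadditive.comp_sum]
    exact Finset.sum_eq_zero fun t _ => by rw [Linear.comp_smul, hf, smul_zero]
  have hsum' : ∀ (c : ι → K) (S : Finset ι) (h : R.complex.d (n + 1) n ≫ (∑ t ∈ S, c t • f t) = 0),
      ∑ t ∈ S, c t • (R.extMk (f t) (n + 1) rfl (hf t) : Ext.{u} X Y n) =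
        R.extMk (∑ t ∈ S, c t • f t) (n + 1) rfl h := by
    classical
    intro c S
    induction S using Finset.induction_on with
    | empty => intro h; exact (R.extMk_zero (n + 1) rfl).symm
    | insert t S ht ih =>
      intro h
      have hS : R.complex.d (n + 1) n ≫ (∑ t ∈ S, c t • f t) = 0 := by
        rw [Preadditive.comp_sum]
        exact Finset.sum_eq_zero fun t _ => by rw [Linear.comp_smul, hf, smul_zero]
      rw [Finset.sum_insert ht, ih hS, smul_extMk, R.add_extMk]
      congr 1
      exact (Finset.sum_insert (f := fun t => c t • f t) ht).symm
  have li : LinearIndependent K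
      fun t => (R.extMk (f t) (n + 1) rfl (hf t) : Ext.{u} X Y n) := by
    refine Fintype.linearIndependent_iff.2 fun c hc => ?_
    rw [hsum' c _ (hsum c)] at hc
    exact congrFun (hind c _ hc)
  have sp : ⊤ ≤ Submodule.span K
      (Set.range fun t => (R.extMk (f t) (n + 1) rfl (hf t) : Ext.{u} X Y n)) := by
    intro z _
    obtain ⟨g, hg, rfl⟩ := R.extMk_surjective z (n + 1) rfl
    obtain ⟨c, hc⟩ := hspan g hg
    have hgc : R.complex.d (n + 1) n ≫ (g - ∑ t, c t • f t) = 0 := by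
      rw [Preadditive.comp_sub, hg, hsum, sub_zero]
    have h := hc hgc
    rw [← R.sub_extMk _ _ _ _ hg (hsum c), sub_eq_zero, ← hsum'] at h
    rw [h]
    exact Submodule.sum_mem _ fun t _ =>
      Submodule.smul_mem _ _ (Submodule.subset_span ⟨t, rfl⟩)
  exact ⟨Module.Basis.mk li sp, fun t => ⟨hf t, Module.Basis.mk_apply li sp t⟩⟩

/-- `Extⁿ` vanishes if every cocycle represents zero. -/
theorem subsingleton_ext_of_extMk_eq_zero (R : ProjectiveResolution X) (n : ℕ)
    (h : ∀ g : R.complex.X n ⟶ Y, ∀ hg : R.complex.d (n + 1) n ≫ g = 0,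
      (R.extMk g (n + 1) rfl hg : Ext.{u} X Y n) = 0) : Subsingleton (Ext.{u} X Y n) := by
  refine subsingleton_of_forall_eq 0 fun z => ?_
  obtain ⟨g, hg, rfl⟩ := R.extMk_surjective z (n + 1) rfl
  exact h g hg

end ExtClasses

namespace CircAlg

/-! ### The cochain complex -/

variable (K : Type u) [Field K] (s : ℕ) [NeZero s]

/-- The bimodule maps from `Qⁿ` to `Λ`. -/
abbrev Cochain (n : ℕ) : Type u := (QComplex K s).X n ⟶ regularBimodule K (Lam K s)

theorem algebraMap_smul_lam (r : K) (z : Lam K s) : algebraMap K (Env K s) r • z = r • z := by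
  have h := onLeft_smul K s r 1
  rw [onLeft_one, mul_one] at h
  rw [← h, onLeft_smul_lam, smul_one_mul]

variable {K s} in
/-- A cochain as a linear map. -/
def toHom {n : ℕ} (g : Cochain K s n) : Q K s n →ₗ[Env K s] Lam K s := g.hom

/-- The value of a cochain at the generator `b i j`. -/
def val (n : ℕ) (i : ZMod s) (j : ℤ) : Cochain K s n →ₗ[K] Lam K s where
  toFun g := toHom g (gen K s n i j)
  map_add' _ _ := rfl
  map_smul' r _ := algebraMap_smul_lam K s r _

/-- The coboundary of a cochain. -/
abbrev cobd {n : ℕ} (g : Cochain K s n) : Cochain K s (n + 1) := (QComplex K s).d (n + 1) n ≫ g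

variable {K s}

theorem cochain_ext {n : ℕ} {f g : Cochain K s n} (h : ∀ i j, val K s n i j f = val K s n i j g) :
    f = g :=
  ModuleCat.hom_ext (hom_ext h)

theorem val_of_not {n : ℕ} {i : ZMod s} {j : ℤ} (h : ¬(0 ≤ j ∧ j ≤ n)) (g : Cochain K s n) :
    val K s n i j g = 0 := by
  change toHom g (gen K s n i j) = 0
  rw [gen_of_not K s h, map_zero]

theorem e_mul_val_mul_e {n : ℕ} (i : ZMod s) (j : ℤ) (g : Cochain K s n) :
    e K s i * val K s n i j g * e K s (i + n) = val K s n i j g := by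
  change e K s i * toHom g (gen K s n i j) * e K s (i + n) = toHom g (gen K s n i j)
  rw [← EnvAlg.mk_smul K, ← map_smul]
  congr 1
  exact ee_gen K s n i j _ rfl

/-- The coboundary in terms of the values at the generators. As in the definition of the complex,
values at indices out of range are zero. -/
theorem val_cobd {n : ℕ} (g : Cochain K s n) (i : ZMod s) (j : ℤ) :
    val K s (n + 1) i j (cobd K s g) =
      val K s n i (j - 1) g * x K s + val K s n i j g * y K s +
        (-1 : K) ^ (n + 1) •
          (y K s * val K s n (i + 1) j g + x K s * val K s n (i + 1) (j - 1) g) := by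
  have hz : ∀ z : Lam K s, ((-1 : ℤ) ^ (n + 1)) • z = ((-1 : K) ^ (n + 1)) • z := fun z => by
    rw [← Int.cast_smul_eq_zsmul K ((-1 : ℤ) ^ (n + 1)) z, Int.cast_pow, Int.cast_neg, Int.cast_one]
  rw [cobd, QComplex_d]
  change toHom g (bd K s n (gen K s (n + 1) i j)) = _
  rw [bd_gen, bdGen]
  simp only [map_add, map_smul, map_zsmul, onLeft_smul_lam, onRight_smul_lam, hz]
  rfl

variable (K s) in
/-- The cochain with prescribed values `z i j`, which have to lie in `e i Λ e (i + n)`. -/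
def mkCochain (n : ℕ) (z : ZMod s → ℤ → Lam K s) : Cochain K s n :=
  ModuleCat.ofHom (homOfGen n fun i j => z i (j : ℕ))

theorem val_mkCochain (n : ℕ) (z : ZMod s → ℤ → Lam K s) {i : ZMod s} {j : ℤ}
    (hj : 0 ≤ j ∧ j ≤ n) : val K s n i j (mkCochain K s n z) =
      e K s i * z i j * e K s (i + n) := by
  obtain ⟨l, rfl⟩ := exists_eq_fin hj
  refine (homOfGen_gen n (fun i (j : Fin (n + 1)) => z i (j : ℕ)) i l).trans ?_
  rw [ee, EnvAlg.mk_smul]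

theorem val_elemMap (n : ℕ) (i : ZMod s) (j : Fin (n + 1)) (z : Lam K s)
    (hz : e K s i * z * e K s (i + (n : ZMod s)) = z) (k : ZMod s) (l : ℤ) :
    val K s n k l (elemMap K s n i j z) = if k = i ∧ l = (j : ℕ) then z else 0 := by
  by_cases hl : 0 ≤ l ∧ l ≤ n
  · obtain ⟨l, rfl⟩ := exists_eq_fin hl
    refine (elemHom_gen K s n i j z hz k l).trans ?_
    congr 1
    simp [Fin.ext_iff]
  · rw [val_of_not hl, if_neg]
    rintro ⟨_, rfl⟩
    omega

theorem e_x_e (i k : ZMod s) :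
    e K s i * x K s * e K s k = if i + 1 = k then e K s i * x K s else 0 := by
  rw [e_mul_x, mul_assoc, e_mul_e_eq_ite]
  split_ifs <;> simp

theorem e_y_e (i k : ZMod s) :
    e K s i * y K s * e K s k = if i + 1 = k then e K s i * y K s else 0 := by
  rw [e_mul_y, mul_assoc, e_mul_e_eq_ite]
  split_ifs <;> simp

theorem e_x_y_e (i k : ZMod s) :
    e K s i * x K s * y K s * e K s k = if i + 2 = k then e K s i * x K s * y K s else 0 := by
  have h : e K s i * x K s * y K s = x K s * y K s * e K s (i + 2) := by
    rw [e_mul_x, mul_assoc, e_mul_y, ← mul_assoc, add_assoc, one_add_one_eq_two]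
  rw [h, mul_assoc, e_mul_e_eq_ite]
  split_ifs <;> simp

theorem e_mul_expand (i : ZMod s) (z : Lam K s) :
    e K s i * z = coeffE K s i z • e K s i + coeffX K s i z • (e K s i * x K s) +
      coeffY K s i z • (e K s i * y K s) + coeffXY K s i z • (e K s i * x K s * y K s) := by
  conv_lhs => rw [lam_expand K s z]
  rw [Finset.mul_sum, Finset.sum_eq_single i]
  · simp only [mul_add, mul_smul_comm, ← mul_assoc, e_mul_e]
  · intro k _ hk
    simp only [mul_add, mul_smul_comm, ← mul_assoc, e_mul_e_of_ne K s hk.symm, zero_mul,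
      smul_zero, add_zero]
  · exact fun h => absurd (Finset.mem_univ _) h

/-- The corner `e i Λ e (i + n)` is spanned by the standard basis elements of degree `n`
modulo `s`. -/
theorem corner_expand {i k : ZMod s} {z : Lam K s} (hz : e K s i * z * e K s (i + k) = z) :
    z = coeffE K s i z • (if k = 0 then e K s i else 0) +
      coeffX K s i z • (if k = 1 then e K s i * x K s else 0) +
      coeffY K s i z • (if k = 1 then e K s i * y K s else 0) +
      coeffXY K s i z • (if k = 2 then e K s i * x K s * y K s else 0) := by
  conv_lhs => rw [← hz, e_mul_expand]
  simp only [add_mul, smul_mul_assoc, e_x_e, e_y_e, e_x_y_e, e_mul_e_eq_ite, add_right_inj,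
    left_eq_add, eq_comm (b := k)]

theorem zmod_one_ne_zero {s : ℕ} (hs : 3 ≤ s) : (1 : ZMod s) ≠ 0 := by
  have : Fact (1 < s) := ⟨by omega⟩
  exact one_ne_zero

theorem zmod_two_ne_zero {s : ℕ} (hs : 3 ≤ s) : (2 : ZMod s) ≠ 0 := by
  intro h
  have h' : ((2 : ℕ) : ZMod s) = 0 := by exact_mod_cast h
  rw [ZMod.natCast_eq_zero_iff] at h'
  exact absurd (Nat.le_of_dvd (by norm_num) h') (by omega)

theorem zmod_two_ne_one {s : ℕ} (hs : 3 ≤ s) : (2 : ZMod s) ≠ 1 := by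
  intro h
  apply zmod_one_ne_zero hs
  have h1 : (2 : ZMod s) = 1 + 1 := one_add_one_eq_two.symm
  rw [h1] at h
  exact add_eq_left.1 h

theorem val_of_cast_eq_zero (hs : 3 ≤ s) {n : ℕ} (hn : (n : ZMod s) = 0) (g : Cochain K s n)
    (i : ZMod s) (j : ℤ) :
    val K s n i j g = coeffE K s i (val K s n i j g) • e K s i := by
  have h := corner_expand (e_mul_val_mul_e i j g)
  rwa [hn, if_pos rfl, if_neg (zmod_one_ne_zero hs).symm, if_neg (zmod_one_ne_zero hs).symm,
    if_neg (zmod_two_ne_zero hs).symm, smul_zero, smul_zero, smul_zero, add_zero, add_zero,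
    add_zero] at h

theorem val_of_cast_eq_one (hs : 3 ≤ s) {n : ℕ} (hn : (n : ZMod s) = 1) (g : Cochain K s n)
    (i : ZMod s) (j : ℤ) :
    val K s n i j g = coeffX K s i (val K s n i j g) • (e K s i * x K s) +
      coeffY K s i (val K s n i j g) • (e K s i * y K s) := by
  have h := corner_expand (e_mul_val_mul_e i j g)
  rwa [hn, if_neg (zmod_one_ne_zero hs), if_pos rfl, if_pos rfl, 
    if_neg (zmod_two_ne_one hs).symm, smul_zero, smul_zero, zero_add, add_zero] at h

theorem val_of_cast_ne {n : ℕ} (h0 : (n : ZMod s) ≠ 0) (h1 : (n : ZMod s) ≠ 1)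
    (g : Cochain K s n) (i : ZMod s) (j : ℤ) :
    val K s n i j g = coeffXY K s i (val K s n i j g) •
      (if (n : ZMod s) = 2 then e K s i * x K s * y K s else 0) := by
  have h := corner_expand (e_mul_val_mul_e i j g)
  rwa [if_neg h0, if_neg h1, if_neg h1, smul_zero, smul_zero, smul_zero, add_zero, add_zero,
    zero_add] at h

theorem val_of_cast_eq_two (hs : 3 ≤ s) {n : ℕ} (hn : (n : ZMod s) = 2) (g : Cochain K s n)
    (i : ZMod s) (j : ℤ) :
    val K s n i j g = coeffXY K s i (val K s n i j g) • (e K s i * x K s * y K s) := by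
  have h := val_of_cast_ne (by rw [hn]; exact zmod_two_ne_zero hs)
    (by rw [hn]; exact zmod_two_ne_one hs) g i j
  rwa [if_pos hn] at h

theorem cochain_eq_zero {n : ℕ} (h0 : (n : ZMod s) ≠ 0) (h1 : (n : ZMod s) ≠ 1)
    (h2 : (n : ZMod s) ≠ 2) (g : Cochain K s n) : g = 0 :=
  cochain_ext fun i j => by rw [val_of_cast_ne h0 h1, if_neg h2, smul_zero, map_zero]

theorem val_cobd_of_e {n : ℕ} {g : Cochain K s n} {c : ZMod s → ℤ → K}
    (hg : ∀ i j, val K s n i j g = c i j • e K s i) (i : ZMod s) (j : ℤ) :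
    val K s (n + 1) i j (cobd K s g) =
      (c i (j - 1) + (-1) ^ (n + 1) * c (i + 1) (j - 1)) • (e K s i * x K s) +
        (c i j + (-1) ^ (n + 1) * c (i + 1) j) • (e K s i * y K s) := by
  rw [val_cobd, hg, hg, hg, hg]
  simp only [smul_mul_assoc, mul_smul_comm, ← e_mul_x, ← e_mul_y, smul_add, smul_smul, add_smul]
  abel

theorem val_cobd_of_e_x_y {n : ℕ} {g : Cochain K s n} {p q : ZMod s → ℤ → K}
    (hg : ∀ i j, val K s n i j g = p i j • (e K s i * x K s) + q i j • (e K s i * y K s))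
    (i : ZMod s) (j : ℤ) :
    val K s (n + 1) i j (cobd K s g) =
      (p i j - q i (j - 1) - (-1) ^ (n + 1) * (p (i + 1) j - q (i + 1) (j - 1))) •
        (e K s i * x K s * y K s) := by
  have h1 : e K s i * y K s * x K s = -(e K s i * x K s * y K s) := by
    rw [mul_assoc, y_mul_x, mul_neg, mul_assoc]
  have h2 : e K s i * x K s * x K s = 0 := by rw [mul_assoc, x_mul_x, mul_zero]
  have h3 : e K s i * y K s * y K s = 0 := by rw [mul_assoc, y_mul_y, mul_zero]
  rw [val_cobd, hg, hg, hg, hg]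
  simp only [add_mul, mul_add, smul_mul_assoc, mul_smul_comm, ← mul_assoc, ← e_mul_x, ← e_mul_y,
    h1, h2, h3, smul_add, smul_smul, smul_neg, smul_zero, add_zero, zero_add, sub_smul, mul_sub]
  abel

theorem cobd_eq_zero_of_e_x_y_mul {n : ℕ} {g : Cochain K s n} {c : ZMod s → ℤ → K}
    (hg : ∀ i j, val K s n i j g = c i j • (e K s i * x K s * y K s)) : cobd K s g = 0 := by
  have h1 : x K s * y K s * x K s = 0 := by
    rw [mul_assoc, y_mul_x, mul_neg, ← mul_assoc, x_mul_x, zero_mul, neg_zero]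
  refine cochain_ext fun i j => ?_
  rw [val_cobd, hg, hg, hg, hg, map_zero]
  simp only [smul_mul_assoc, mul_smul_comm, mul_assoc, y_mul_y, mul_zero]
  simp only [← mul_assoc, ← e_mul_x, ← e_mul_y]
  simp only [mul_assoc, x_x_y, y_x_y]
  simp only [← mul_assoc (x K s), h1, mul_zero, smul_zero, add_zero]

/-! ### Cyclic linear algebra -/

theorem eq_of_forall_eq_add_one {A : Type*} {c : ZMod s → A} (h : ∀ i, c i = c (i + 1))
    (i k : ZMod s) : c i = c k := by
  have h0 : ∀ n : ℕ, c (n : ZMod s) = c 0 := by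
    intro n
    induction n with
    | zero => rw [Nat.cast_zero]
    | succ n ih => rw [Nat.cast_succ, ← h, ih]
  rw [← ZMod.natCast_zmod_val i, ← ZMod.natCast_zmod_val k, h0, h0]

theorem sum_sub_add_one (c : ZMod s → K) : ∑ i, (c i - c (i + 1)) = 0 := by
  rw [Finset.sum_sub_distrib, sub_eq_zero]
  exact (Equiv.sum_comp (Equiv.addRight (1 : ZMod s)) c).symm

/-- Up to a correction at the place `-1` by the sum of its values, every function on `ZMod s` is a
difference of consecutive values. -/
theorem exists_sub_add_one (t : ZMod s → K) :
    ∃ c : ZMod s → K, ∀ i, c i - c (i + 1) = t i - if i = -1 then ∑ k, t k else 0 := by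
  refine ⟨fun i => -∑ l ∈ Finset.range i.val, t (l : ZMod s), fun i => ?_⟩
  beta_reduce
  have hsum : ∑ k, t k = ∑ l ∈ Finset.range s, t (l : ZMod s) := by
    refine (Finset.sum_bij' (fun (l : ℕ) _ => (l : ZMod s)) (fun k _ => k.val) ?_ ?_ ?_ ?_ ?_).symm
    · exact fun _ _ => Finset.mem_univ _
    · exact fun k _ => Finset.mem_range.2 (ZMod.val_lt k)
    · exact fun l hl => ZMod.val_cast_of_lt (Finset.mem_range.1 hl)
    · exact fun k _ => ZMod.natCast_zmod_val k
    · exact fun _ _ => rfl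
  have hlt := ZMod.val_lt i
  have hstep : ∑ l ∈ Finset.range (i.val + 1), t (l : ZMod s) =
      ∑ l ∈ Finset.range i.val, t (l : ZMod s) + t i := by
    rw [Finset.sum_range_succ, ZMod.natCast_zmod_val]
  have hcast : i + 1 = ((i.val + 1 : ℕ) : ZMod s) := by
    rw [Nat.cast_succ, ZMod.natCast_zmod_val]
  by_cases hi : i.val + 1 = s
  · have h0 : i + 1 = 0 := by rw [hcast, hi, ZMod.natCast_self]
    rw [hi] at hstep
    rw [if_pos (eq_neg_of_add_eq_zero_left h0), h0, ZMod.val_zero, Finset.sum_range_zero, hsum,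
      hstep]
    ring
  · have hv : (i + 1).val = i.val + 1 := by
      rw [hcast]
      exact ZMod.val_cast_of_lt (by omega)
    have hne : i ≠ -1 := by
      rintro rfl
      rw [neg_add_cancel, ZMod.val_zero] at hv
      omega
    rw [if_neg hne, hv, hstep]
    ring

/-- For odd `s`, going once around the cycle changes the sign of such a function. -/
theorem eq_zero_of_forall_eq_neg_add_one {s : ℕ} (hs : Odd s) (h2 : (2 : K) ≠ 0) {c : ZMod s → K}
    (h : ∀ i, c i + c (i + 1) = 0) : c = 0 := by
  have hn : ∀ (n : ℕ) (i : ZMod s), c (i + n) = (-1) ^ n * c i := by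
    intro n i
    induction n with
    | zero => rw [Nat.cast_zero, add_zero, pow_zero, one_mul]
    | succ n ih =>
      rw [Nat.cast_succ, ← add_assoc, eq_neg_of_add_eq_zero_right (h (i + n)), ih]
      ring
  funext i
  have h' := hn s i
  rw [ZMod.natCast_self, add_zero, hs.neg_one_pow] at h'
  have h'' : 2 * c i = 0 := by linear_combination h'
  exact (mul_eq_zero.1 h'').resolve_left h2

/-- The operator `c ↦ (i ↦ c i + c (i + 1))` is injective, hence bijective. -/
theorem exists_add_add_one (hs : Odd s) (h2 : (2 : K) ≠ 0) (t : ZMod s → K) :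
    ∃ c : ZMod s → K, ∀ i, c i + c (i + 1) = t i := by
  let L : (ZMod s → K) →ₗ[K] (ZMod s → K) :=
    LinearMap.id + LinearMap.funLeft K K (fun i => i + 1)
  have hL : Function.Injective L := by
    rw [← LinearMap.ker_eq_bot, LinearMap.ker_eq_bot']
    exact fun c hc => eq_zero_of_forall_eq_neg_add_one hs h2 fun i => congrFun hc i
  obtain ⟨c, hc⟩ := LinearMap.injective_iff_surjective.1 hL t
  exact ⟨c, fun i => congrFun hc i⟩

/-! ### Coordinates of cochains -/

section coordinates

variable (K s)

/-- The coefficient of `e i` in the value at `b i j`. -/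
def coordE (n : ℕ) (i : ZMod s) (j : ℤ) : Cochain K s n →ₗ[K] K := coeffE K s i ∘ₗ val K s n i j

/-- The coefficient of `e i x` in the value at `b i j`. -/
def coordX (n : ℕ) (i : ZMod s) (j : ℤ) : Cochain K s n →ₗ[K] K := coeffX K s i ∘ₗ val K s n i j

/-- The coefficient of `e i y` in the value at `b i j`. -/
def coordY (n : ℕ) (i : ZMod s) (j : ℤ) : Cochain K s n →ₗ[K] K := coeffY K s i ∘ₗ val K s n i j

/-- The coefficient of `e i xy` in the value at `b i j`. -/
def coordXY (n : ℕ) (i : ZMod s) (j : ℤ) : Cochain K s n →ₗ[K] K := coeffXY K s i ∘ₗ val K s n i j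

variable {K s} {n : ℕ} {i : ZMod s} {j : ℤ}

theorem coordE_of_not (h : ¬(0 ≤ j ∧ j ≤ n)) (g : Cochain K s n) : coordE K s n i j g = 0 := by
  rw [coordE, LinearMap.comp_apply, val_of_not h, map_zero]

theorem coordX_of_not (h : ¬(0 ≤ j ∧ j ≤ n)) (g : Cochain K s n) : coordX K s n i j g = 0 := by
  rw [coordX, LinearMap.comp_apply, val_of_not h, map_zero]

theorem coordY_of_not (h : ¬(0 ≤ j ∧ j ≤ n)) (g : Cochain K s n) : coordY K s n i j g = 0 := by
  rw [coordY, LinearMap.comp_apply, val_of_not h, map_zero]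

theorem coordXY_of_not (h : ¬(0 ≤ j ∧ j ≤ n)) (g : Cochain K s n) : coordXY K s n i j g = 0 := by
  rw [coordXY, LinearMap.comp_apply, val_of_not h, map_zero]

theorem cochain_ext_zero (hs : 3 ≤ s) (hn : (n : ZMod s) = 0) {f g : Cochain K s n}
    (h : ∀ i j, coordE K s n i j f = coordE K s n i j g) : f = g :=
  cochain_ext fun i j => by
    rw [val_of_cast_eq_zero hs hn f, val_of_cast_eq_zero hs hn g]
    exact congrArg (· • e K s i) (h i j)

theorem cochain_ext_one (hs : 3 ≤ s) (hn : (n : ZMod s) = 1) {f g : Cochain K s n}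
    (hX : ∀ i j, coordX K s n i j f = coordX K s n i j g)
    (hY : ∀ i j, coordY K s n i j f = coordY K s n i j g) : f = g :=
  cochain_ext fun i j => by
    rw [val_of_cast_eq_one hs hn f, val_of_cast_eq_one hs hn g]
    exact congrArg₂ (fun a b => a • (e K s i * x K s) + b • (e K s i * y K s)) (hX i j) (hY i j)

theorem cochain_ext_two (hs : 3 ≤ s) (hn : (n : ZMod s) = 2) {f g : Cochain K s n}
    (h : ∀ i j, coordXY K s n i j f = coordXY K s n i j g) : f = g :=
  cochain_ext fun i j => by
    rw [val_of_cast_eq_two hs hn f, val_of_cast_eq_two hs hn g]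
    exact congrArg (· • (e K s i * x K s * y K s)) (h i j)

theorem coordX_cobd (hs : 3 ≤ s) (hn : (n : ZMod s) = 0) (g : Cochain K s n) (i : ZMod s) (j : ℤ) :
    coordX K s (n + 1) i j (cobd K s g) =
      coordE K s n i (j - 1) g + (-1) ^ (n + 1) * coordE K s n (i + 1) (j - 1) g := by
  rw [coordX, LinearMap.comp_apply, val_cobd_of_e (val_of_cast_eq_zero hs hn g), map_add, map_smul,
    map_smul, coeffX_e_x, coeffX_e_y, if_pos rfl, smul_zero, add_zero, smul_eq_mul, mul_one]
  rfl

theorem coordY_cobd (hs : 3 ≤ s) (hn : (n : ZMod s) = 0) (g : Cochain K s n) (i : ZMod s) (j : ℤ) :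
    coordY K s (n + 1) i j (cobd K s g) =
      coordE K s n i j g + (-1) ^ (n + 1) * coordE K s n (i + 1) j g := by
  rw [coordY, LinearMap.comp_apply, val_cobd_of_e (val_of_cast_eq_zero hs hn g), map_add, map_smul,
    map_smul, coeffY_e_x, coeffY_e_y, if_pos rfl, smul_zero, zero_add, smul_eq_mul, mul_one]
  rfl

theorem coordXY_cobd (hs : 3 ≤ s) (hn : (n : ZMod s) = 1) (g : Cochain K s n) (i : ZMod s)
    (j : ℤ) :
    coordXY K s (n + 1) i j (cobd K s g) =
      coordX K s n i j g - coordY K s n i (j - 1) g -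
        (-1) ^ (n + 1) * (coordX K s n (i + 1) j g - coordY K s n (i + 1) (j - 1) g) := by
  rw [coordXY, LinearMap.comp_apply, val_cobd_of_e_x_y (val_of_cast_eq_one hs hn g), map_smul,
    coeffXY_e_x_y, if_pos rfl, smul_eq_mul, mul_one]
  rfl

theorem cobd_eq_zero_of_cast_eq_two (hs : 3 ≤ s) (hn : (n : ZMod s) = 2) (g : Cochain K s n) :
    cobd K s g = 0 :=
  cobd_eq_zero_of_e_x_y_mul (val_of_cast_eq_two hs hn g)

/-- There are no coboundaries in the degrees divisible by `s`. In the degree before, the values of a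
cochain are zero if `s > 3`, and they are multiples of the socle elements `e i xy` if `s = 3`. -/
theorem cobd_eq_zero_of_cast_succ_eq_zero (hs : 3 ≤ s) (hn : ((n + 1 : ℕ) : ZMod s) = 0)
    (g : Cochain K s n) : cobd K s g = 0 := by
  have h : (n : ZMod s) = -1 := eq_neg_of_add_eq_zero_left (by exact_mod_cast hn)
  have h0 : (n : ZMod s) ≠ 0 := by
    rw [h]
    exact neg_ne_zero.2 (zmod_one_ne_zero hs)
  have h1 : (n : ZMod s) ≠ 1 := by
    intro h1
    apply zmod_two_ne_zero hs
    rw [h1] at h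
    rw [← one_add_one_eq_two]
    nth_rewrite 1 [h]
    exact neg_add_cancel 1
  by_cases h2 : (n : ZMod s) = 2
  · exact cobd_eq_zero_of_cast_eq_two hs h2 g
  · rw [cochain_eq_zero h0 h1 h2 g, cobd, Limits.comp_zero]

/-- In degrees divisible by `s`, the coordinates of a cochain can be prescribed. -/
theorem exists_coordE_eq (hn : (n : ZMod s) = 0) (c : ZMod s → ℤ → K) :
    ∃ g : Cochain K s n, ∀ (i : ZMod s) (j : ℤ), 0 ≤ j ∧ j ≤ n → coordE K s n i j g = c i j := by
  refine ⟨mkCochain K s n fun i j => c i j • e K s i, fun i j hj => ?_⟩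
  rw [coordE, LinearMap.comp_apply, val_mkCochain n _ hj, hn, add_zero, mul_smul_comm,
    smul_mul_assoc, e_mul_e, e_mul_e, map_smul, coeffE_e, if_pos rfl, smul_eq_mul, mul_one]

/-- In degrees congruent to `1` modulo `s`, the coordinates of a cochain can be prescribed. -/
theorem exists_coordX_coordY_eq (hn : (n : ZMod s) = 1) (p q : ZMod s → ℤ → K) :
    ∃ g : Cochain K s n, ∀ (i : ZMod s) (j : ℤ), 0 ≤ j ∧ j ≤ n →
      coordX K s n i j g = p i j ∧ coordY K s n i j g = q i j := by
  refine ⟨mkCochain K s n fun i j => p i j • (e K s i * x K s) + q i j • (e K s i * y K s),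
    fun i j hj => ?_⟩
  have hv := val_mkCochain (K := K) n
    (fun i j => p i j • (e K s i * x K s) + q i j • (e K s i * y K s)) (i := i) hj
  rw [hn, mul_add, add_mul, mul_smul_comm, smul_mul_assoc, mul_smul_comm, smul_mul_assoc,
    ← mul_assoc, ← mul_assoc, e_mul_e, e_x_e, e_y_e, if_pos rfl, if_pos rfl] at hv
  constructor
  · rw [coordX, LinearMap.comp_apply, hv, map_add, map_smul, map_smul, coeffX_e_x, coeffX_e_y,
      if_pos rfl, smul_zero, add_zero, smul_eq_mul, mul_one]
  · rw [coordY, LinearMap.comp_apply, hv, map_add, map_smul, map_smul, coeffY_e_x, coeffY_e_y,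
      if_pos rfl, smul_zero, zero_add, smul_eq_mul, mul_one]

theorem coordE_alpha (hn : (n : ZMod s) = 0) (k : ZMod s) (l : Fin (n + 1)) :
    coordE K s n i j (alpha K s n k l) = if i = k ∧ j = (l : ℕ) then 1 else 0 := by
  rw [coordE, LinearMap.comp_apply, alpha, val_elemMap]
  · split_ifs with h
    · rw [coeffE_e, if_pos h.1.symm]
    · exact map_zero _
  · rw [hn, add_zero, e_mul_e, e_mul_e]

theorem val_beta (hn : (n : ZMod s) = 1) (k : ZMod s) (l : Fin (n + 1)) :
    val K s n i j (beta K s n k l) = if i = k ∧ j = (l : ℕ) then e K s k * x K s else 0 :=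
  val_elemMap n k l _ (by rw [hn, ← mul_assoc, e_mul_e, e_x_e, if_pos rfl]) i j

theorem val_gamma (hn : (n : ZMod s) = 1) (k : ZMod s) (l : Fin (n + 1)) :
    val K s n i j (gamma K s n k l) = if i = k ∧ j = (l : ℕ) then e K s k * y K s else 0 :=
  val_elemMap n k l _ (by rw [hn, ← mul_assoc, e_mul_e, e_y_e, if_pos rfl]) i j

theorem coordX_beta (hn : (n : ZMod s) = 1) (k : ZMod s) (l : Fin (n + 1)) :
    coordX K s n i j (beta K s n k l) = if i = k ∧ j = (l : ℕ) then 1 else 0 := by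
  rw [coordX, LinearMap.comp_apply, val_beta hn]
  split_ifs with h
  · rw [coeffX_e_x, if_pos h.1.symm]
  · exact map_zero _

theorem coordY_beta (hn : (n : ZMod s) = 1) (k : ZMod s) (l : Fin (n + 1)) :
    coordY K s n i j (beta K s n k l) = 0 := by
  rw [coordY, LinearMap.comp_apply, val_beta hn]
  split_ifs
  · exact coeffY_e_x K s _ _
  · exact map_zero _

theorem coordX_gamma (hn : (n : ZMod s) = 1) (k : ZMod s) (l : Fin (n + 1)) :
    coordX K s n i j (gamma K s n k l) = 0 := by
  rw [coordX, LinearMap.comp_apply, val_gamma hn]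
  split_ifs
  · exact coeffX_e_y K s _ _
  · exact map_zero _

theorem coordY_gamma (hn : (n : ZMod s) = 1) (k : ZMod s) (l : Fin (n + 1)) :
    coordY K s n i j (gamma K s n k l) = if i = k ∧ j = (l : ℕ) then 1 else 0 := by
  rw [coordY, LinearMap.comp_apply, val_gamma hn]
  split_ifs with h
  · rw [coeffY_e_y, if_pos h.1.symm]
  · exact map_zero _

theorem coordXY_delta (hn : (n : ZMod s) = 2) (k : ZMod s) (l : Fin (n + 1)) :
    coordXY K s n i j (delta K s n k l) = if i = k ∧ j = (l : ℕ) then 1 else 0 := by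
  rw [coordXY, LinearMap.comp_apply, delta, val_elemMap]
  · split_ifs with h
    · rw [coeffXY_e_x_y, if_pos h.1.symm]
    · exact map_zero _
  · rw [hn, ← mul_assoc, ← mul_assoc, e_mul_e, e_x_y_e, if_pos rfl]

/-- A sum over `Fin N` that picks out one value of a function on the integers. -/
theorem sum_fin_mul_ite (W : ℤ → K) {N : ℕ} (hW : ∀ l : ℤ, ¬(0 ≤ l ∧ l < N) → W l = 0) (l : ℤ) :
    ∑ k : Fin N, W (k : ℕ) * (if l = (k : ℕ) then 1 else 0) = W l := by
  by_cases h : 0 ≤ l ∧ l < N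
  · rw [Finset.sum_eq_single ⟨l.toNat, by omega⟩]
    · have : ((l.toNat : ℕ) : ℤ) = l := by omega
      simp only [this, if_true, mul_one]
    · intro k _ hk
      rw [if_neg, mul_zero]
      rintro rfl
      exact hk (Fin.ext (by simp))
    · exact fun h => absurd (Finset.mem_univ _) h
  · rw [hW l h]
    refine Finset.sum_eq_zero fun k _ => ?_
    rw [if_neg (by omega), mul_zero]

/-- A function on `Fin N` is the restriction of a function on the integers that is zero outside of
the range. -/
theorem exists_int_extension {N : ℕ} (w : Fin N → K) :
    ∃ W : ℤ → K, (∀ l : ℤ, ¬(0 ≤ l ∧ l < N) → W l = 0) ∧ w = fun k : Fin N => W (k : ℕ) := by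
  refine ⟨fun l => if h : 0 ≤ l ∧ l < N then w ⟨l.toNat, by omega⟩ else 0,
    fun l hl => dif_neg hl, funext fun k => ?_⟩
  have hk : (0 : ℤ) ≤ (k : ℕ) ∧ ((k : ℕ) : ℤ) < N := by omega
  beta_reduce
  rw [dif_pos hk]
  exact congrArg w (Fin.ext (by simp))

end coordinates

/-! ### Classes of cocycles -/

variable {n : ℕ}

theorem extMk_eq_zero_iff_succ (h : QuasiIso (QAug K s)) (f : Cochain K s (n + 1))
    (hf : cobd K s f = 0) :
    ((QResolution K s h).extMk f (n + 1 + 1) rfl hf : HH K (Lam K s) (n + 1)) = 0 ↔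
      ∃ g : Cochain K s n, cobd K s g = f :=
  (QResolution K s h).extMk_eq_zero_iff f (n + 1 + 1) rfl hf n rfl

theorem extMk_eq_zero_iff_of_cast_eq_zero (h : QuasiIso (QAug K s)) (hs : 3 ≤ s)
    (hn : (n : ZMod s) = 0) (f : Cochain K s n) (hf : cobd K s f = 0) :
    ((QResolution K s h).extMk f (n + 1) rfl hf : HH K (Lam K s) n) = 0 ↔ f = 0 := by
  cases n with
  | zero => exact extMk_eq_zero_iff_of_degree_zero (QResolution K s h) f 1 rfl hf
  | succ n =>
    rw [extMk_eq_zero_iff_succ]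
    refine ⟨?_, ?_⟩
    · rintro ⟨g, rfl⟩
      exact cobd_eq_zero_of_cast_succ_eq_zero hs hn g
    · rintro rfl
      exact ⟨0, Limits.comp_zero⟩

/-- The criterion for a family of cocycles to represent a basis in a degree without
coboundaries. -/
theorem classesFormBasis_of_cast_eq_zero (h : QuasiIso (QAug K s)) (hs : 3 ≤ s)
    (hn : (n : ZMod s) = 0) {ι : Type} [Fintype ι] (f : ι → Cochain K s n)
    (hf : ∀ t, cobd K s (f t) = 0)
    (hspan : ∀ g : Cochain K s n, cobd K s g = 0 → ∃ c : ι → K, g = ∑ t, c t • f t)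
    (hind : ∀ c : ι → K, ∑ t, c t • f t = 0 → c = 0) :
    ClassesFormBasis K (QResolution K s h) n f := by
  refine ClassesFormBasis.mk' (QResolution K s h) n f hf (fun g hg => ?_) (fun c hc h0 => ?_)
  · obtain ⟨c, hc⟩ := hspan g hg
    exact ⟨c, fun hh =>
      (extMk_eq_zero_iff_of_cast_eq_zero h hs hn _ hh).2 (sub_eq_zero.2 hc)⟩
  · exact hind c ((extMk_eq_zero_iff_of_cast_eq_zero h hs hn _ hc).1 h0)

/-- The criterion for a family of cocycles to represent a basis in positive degree. -/
theorem classesFormBasis_succ (h : QuasiIso (QAug K s))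
    {ι : Type} [Fintype ι] (f : ι → Cochain K s (n + 1))
    (hf : ∀ t, cobd K s (f t) = 0)
    (hspan : ∀ g : Cochain K s (n + 1), cobd K s g = 0 →
      ∃ (c : ι → K) (g' : Cochain K s n), g = cobd K s g' + ∑ t, c t • f t)
    (hind : ∀ (c : ι → K) (g' : Cochain K s n), cobd K s g' = ∑ t, c t • f t → c = 0) :
    ClassesFormBasis K (QResolution K s h) (n + 1) f := by
  refine ClassesFormBasis.mk' (QResolution K s h) (n + 1) f hf (fun g hg => ?_)
    (fun c hc h0 => ?_)
  · obtain ⟨c, g', hc⟩ := hspan g hg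
    exact ⟨c, fun hh =>
      (extMk_eq_zero_iff_succ h _ hh).2 ⟨g', eq_sub_of_add_eq hc.symm⟩⟩
  · obtain ⟨g', hg'⟩ := (extMk_eq_zero_iff_succ h _ hc).1 h0
    exact hind c g' hg'

/-! ### Vanishing -/

theorem subsingleton_HH_of_cast_ne (h : QuasiIso (QAug K s)) (h0 : (n : ZMod s) ≠ 0)
    (h1 : (n : ZMod s) ≠ 1) (h2 : (n : ZMod s) ≠ 2) : Subsingleton (HH K (Lam K s) n) := by
  refine subsingleton_ext_of_extMk_eq_zero (QResolution K s h) n fun g hg => ?_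
  obtain rfl : g = 0 := cochain_eq_zero h0 h1 h2 g
  exact (QResolution K s h).extMk_zero (n + 1) rfl

theorem subsingleton_HH_succ (h : QuasiIso (QAug K s))
    (hex : ∀ g : Cochain K s (n + 1), cobd K s g = 0 → ∃ g' : Cochain K s n, cobd K s g' = g) :
    Subsingleton (HH K (Lam K s) (n + 1)) :=
  subsingleton_ext_of_extMk_eq_zero (QResolution K s h) (n + 1) fun g hg =>
    (extMk_eq_zero_iff_succ h g hg).2 (hex g hg)

theorem cast_succ_eq_one {s : ℕ} (hn : (n : ZMod s) = 0) : ((n + 1 : ℕ) : ZMod s) = 1 := by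
  rw [Nat.cast_succ, hn, zero_add]

theorem cast_succ_succ_eq_two {s : ℕ} (hn : (n : ZMod s) = 0) : ((n + 1 + 1 : ℕ) : ZMod s) = 2 := by
  rw [Nat.cast_succ, cast_succ_eq_one hn, one_add_one_eq_two]

theorem subsingleton_HH_of_odd (h : QuasiIso (QAug K s)) (hs : 3 ≤ s) (hn : (n : ZMod s) = 0)
    (hodd : Odd s) (h2 : (2 : K) ≠ 0) (hε : (-1 : K) ^ n = -1) :
    Subsingleton (HH K (Lam K s) n) := by
  refine subsingleton_ext_of_extMk_eq_zero (QResolution K s h) n fun g hg => ?_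
  refine (extMk_eq_zero_iff_of_cast_eq_zero h hs hn g hg).2 (cochain_ext_zero hs hn fun i j => ?_)
  rw [map_zero]
  refine congrFun (eq_zero_of_forall_eq_neg_add_one hodd h2
    (c := fun i => coordE K s n i j g) fun i => ?_) i
  have hY := coordY_cobd hs hn g i j
  rw [show cobd K s g = 0 from hg, map_zero, pow_succ, hε] at hY
  linear_combination -hY

theorem subsingleton_HH_succ_of_odd (h : QuasiIso (QAug K s)) (hs : 3 ≤ s)
    (hn : (n : ZMod s) = 0) (hodd : Odd s) (h2 : (2 : K) ≠ 0) (hε : (-1 : K) ^ n = -1) :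
    Subsingleton (HH K (Lam K s) (n + 1)) := by
  have hn1 := cast_succ_eq_one hn
  refine subsingleton_HH_succ h fun g hg => ?_
  -- the cocycle condition forces the coordinates at `x` and `y` to agree
  have hXY : ∀ i j, coordX K s (n + 1) i j g = coordY K s (n + 1) i (j - 1) g := by
    intro i j
    refine sub_eq_zero.1 (congrFun (eq_zero_of_forall_eq_neg_add_one hodd h2
      (c := fun i => coordX K s (n + 1) i j g - coordY K s (n + 1) i (j - 1) g) fun i => ?_) i)
    have hc := coordXY_cobd hs hn1 g i j
    rw [hg, map_zero, pow_succ, pow_succ, hε] at hc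
    linear_combination -hc
  choose c hc using fun j => exists_add_add_one hodd h2 fun i => coordY K s (n + 1) i j g
  obtain ⟨g', hg'⟩ := exists_coordE_eq hn fun i j => c j i
  have hY : ∀ i j, coordY K s (n + 1) i j (cobd K s g') = coordY K s (n + 1) i j g := by
    intro i j
    rw [coordY_cobd hs hn, pow_succ, hε]
    by_cases hj : 0 ≤ j ∧ j ≤ n
    · rw [hg' _ _ hj, hg' _ _ hj]
      linear_combination hc j i
    · have hr : coordY K s (n + 1) i j g = 0 := by
        have hx := hXY i (j + 1)
        rw [add_sub_cancel_right] at hx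
        by_cases hj' : j < 0
        · exact coordY_of_not (by omega) g
        · rw [← hx]
          exact coordX_of_not (by push_cast; omega) g
      rw [coordE_of_not hj, coordE_of_not hj, hr]
      ring
  refine ⟨g', cochain_ext_one hs hn1 (fun i j => ?_) hY⟩
  rw [hXY, ← hY, coordX_cobd hs hn, coordY_cobd hs hn]

/-- Every function on the vertices and on the indices `0 ≤ j ≤ n + 1` is the difference of the
coordinates at `x` and, shifted by one, at `y` of some cochain. -/
theorem exists_coordX_sub_coordY_eq (hn : (n : ZMod s) = 1) (c : ZMod s → ℤ → K) :
    ∃ g : Cochain K s n, ∀ (i : ZMod s) (j : ℤ), 0 ≤ j ∧ j ≤ (n + 1 : ℕ) →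
      coordX K s n i j g - coordY K s n i (j - 1) g = c i j := by
  obtain ⟨g, hg⟩ := exists_coordX_coordY_eq hn (fun i j => if j = 0 then c i j else 0)
    fun i j => -c i (j + 1)
  refine ⟨g, fun i j hj => ?_⟩
  by_cases h0 : j = 0
  · rw [(hg i j (by omega)).1, if_pos h0, coordY_of_not (by omega), sub_zero]
  · rw [(hg i (j - 1) (by push_cast at hj; omega)).2, sub_add_cancel, sub_neg_eq_add]
    by_cases hj' : j ≤ n
    · rw [(hg i j (by omega)).1, if_neg h0, zero_add]
    · rw [coordX_of_not (by omega), zero_add]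

theorem subsingleton_HH_succ_succ_of_odd (h : QuasiIso (QAug K s)) (hs : 3 ≤ s)
    (hn : (n : ZMod s) = 0) (hodd : Odd s) (h2 : (2 : K) ≠ 0) (hε : (-1 : K) ^ n = -1) :
    Subsingleton (HH K (Lam K s) (n + 1 + 1)) := by
  have hn1 := cast_succ_eq_one hn
  refine subsingleton_HH_succ h fun g _ => ?_
  choose c hc using fun j => exists_add_add_one hodd h2 fun i => coordXY K s (n + 1 + 1) i j g
  obtain ⟨g', hg'⟩ := exists_coordX_sub_coordY_eq hn1 fun i j => c j i
  refine ⟨g', cochain_ext_two hs (cast_succ_succ_eq_two hn) fun i j => ?_⟩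
  by_cases hj : 0 ≤ j ∧ j ≤ (n + 1 + 1 : ℕ)
  · rw [coordXY_cobd hs hn1, hg' _ _ hj, hg' _ _ hj, pow_succ, pow_succ, hε]
    linear_combination hc j i
  · rw [coordXY_of_not hj, coordXY_of_not hj]

/-! ### Bases -/

theorem natCast_sub_one : ((s - 1 : ℕ) : ZMod s) = -1 := by
  rw [Nat.cast_sub (Nat.one_le_iff_ne_zero.2 (NeZero.ne s)), ZMod.natCast_self, Nat.cast_one,
    zero_sub]

variable (K s n) in
/-- The sums `∑ i, α i j`. -/
def sumAlpha (j : Fin (n + 1)) : Cochain K s n := ∑ i : ZMod s, alpha K s n i j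

theorem coordE_sumAlpha (hn : (n : ZMod s) = 0) (i : ZMod s) (j : ℤ) (l : Fin (n + 1)) :
    coordE K s n i j (sumAlpha K s n l) = if j = (l : ℕ) then 1 else 0 := by
  rw [sumAlpha, map_sum]
  simp only [coordE_alpha hn, ite_and, Finset.sum_ite_eq, Finset.mem_univ, if_true]

/-- The classes of the sums `∑ i, α i j` form a basis. -/
theorem classesFormBasis_sumAlpha (h : QuasiIso (QAug K s)) (hs : 3 ≤ s) (hn : (n : ZMod s) = 0)
    (hε : (-1 : K) ^ n = 1) :
    ClassesFormBasis K (QResolution K s h) n (sumAlpha K s n) := by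
  have hcomb : ∀ W : ℤ → K, (∀ l : ℤ, ¬(0 ≤ l ∧ l < (n + 1 : ℕ)) → W l = 0) → ∀ i j,
      coordE K s n i j (∑ t : Fin (n + 1), W (t : ℕ) • sumAlpha K s n t) = W j := by
    intro W hW i j
    rw [map_sum, ← sum_fin_mul_ite W hW j]
    exact Finset.sum_congr rfl fun t _ => by rw [map_smul, coordE_sumAlpha hn, smul_eq_mul]
  refine classesFormBasis_of_cast_eq_zero h hs hn _ (fun t => ?_) (fun g hg => ?_)
    (fun c hc => ?_)
  · refine cochain_ext_one hs (cast_succ_eq_one hn) (fun i j => ?_) fun i j => ?_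
    · rw [coordX_cobd hs hn, coordE_sumAlpha hn, coordE_sumAlpha hn, map_zero, pow_succ, hε]
      ring
    · rw [coordY_cobd hs hn, coordE_sumAlpha hn, coordE_sumAlpha hn, map_zero, pow_succ, hε]
      ring
  · refine ⟨fun j => coordE K s n 0 (j : ℕ) g, cochain_ext_zero hs hn fun i j => ?_⟩
    rw [hcomb (fun j => coordE K s n 0 j g)
      (fun l hl => coordE_of_not (by push_cast at hl; omega) g)]
    refine eq_of_forall_eq_add_one (c := fun i => coordE K s n i j g) (fun i => ?_) i 0
    have hY := coordY_cobd hs hn g i j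
    rw [hg, map_zero, pow_succ, hε] at hY
    linear_combination -hY
  · obtain ⟨W, hW, rfl⟩ := exists_int_extension c
    funext t
    rw [← hcomb W hW 0, hc, map_zero, Pi.zero_apply]

theorem coordXY_delta_neg_one (hn : (n : ZMod s) = 2) (i : ZMod s) (j : ℤ) (l : Fin (n + 1)) :
    coordXY K s n i j (delta K s n ((s - 1 : ℕ) : ZMod s) l) =
      if i = -1 then if j = (l : ℕ) then 1 else 0 else 0 := by
  rw [coordXY_delta hn, natCast_sub_one, ite_and]

/-- The classes of the maps `δ (s-1) j` form a basis. -/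
theorem classesFormBasis_delta (h : QuasiIso (QAug K s)) (hs : 3 ≤ s) (hn : (n : ZMod s) = 0)
    (hε : (-1 : K) ^ n = 1) :
    ClassesFormBasis K (QResolution K s h) (n + 1 + 1)
      (fun j : Fin (n + 1 + 1 + 1) => delta K s (n + 1 + 1) ((s - 1 : ℕ) : ZMod s) j) := by
  have hn1 := cast_succ_eq_one hn
  have hn2 := cast_succ_succ_eq_two hn
  have hcomb : ∀ W : ℤ → K, (∀ l : ℤ, ¬(0 ≤ l ∧ l < (n + 1 + 1 + 1 : ℕ)) → W l = 0) → ∀ i j,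
      coordXY K s (n + 1 + 1) i j (∑ t : Fin (n + 1 + 1 + 1),
        W (t : ℕ) • delta K s (n + 1 + 1) ((s - 1 : ℕ) : ZMod s) t) =
          if i = -1 then W j else 0 := by
    intro W hW i j
    simp only [map_sum, map_smul, coordXY_delta_neg_one hn2, smul_eq_mul]
    split_ifs
    · exact sum_fin_mul_ite W hW j
    · simp only [mul_zero, Finset.sum_const_zero]
  have hcob : ∀ (g : Cochain K s (n + 1)) i j, coordXY K s (n + 1 + 1) i j (cobd K s g) =
      (coordX K s (n + 1) i j g - coordY K s (n + 1) i (j - 1) g) -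
        (coordX K s (n + 1) (i + 1) j g - coordY K s (n + 1) (i + 1) (j - 1) g) := by
    intro g i j
    rw [coordXY_cobd hs hn1, pow_succ, pow_succ, hε]
    ring
  refine classesFormBasis_succ h _ (fun t => cobd_eq_zero_of_cast_eq_two hs hn2 _)
    (fun g hg => ?_) (fun c g' hc => ?_)
  · choose c hc using fun j => exists_sub_add_one fun i => coordXY K s (n + 1 + 1) i j g
    obtain ⟨g', hg'⟩ := exists_coordX_sub_coordY_eq hn1 fun i j => c j i
    refine ⟨fun j => ∑ i, coordXY K s (n + 1 + 1) i (j : ℕ) g, g',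
      cochain_ext_two hs hn2 fun i j => ?_⟩
    rw [map_add, hcomb (fun j => ∑ i, coordXY K s (n + 1 + 1) i j g)
      (fun l hl => Finset.sum_eq_zero fun i _ => coordXY_of_not (by push_cast at *; omega) g), hcob]
    by_cases hj : 0 ≤ j ∧ j ≤ (n + 1 + 1 : ℕ)
    · rw [hg' _ _ hj, hg' _ _ hj, hc, sub_add_cancel]
    · rw [← hcob, coordXY_of_not hj, coordXY_of_not hj]
      simp only [coordXY_of_not hj, Finset.sum_const_zero, ite_self, add_zero]
  · obtain ⟨W, hW, rfl⟩ := exists_int_extension c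
    funext t
    have hsum := sum_sub_add_one fun i =>
      coordX K s (n + 1) i (t : ℕ) g' - coordY K s (n + 1) i ((t : ℕ) - 1) g'
    simp only [← hcob, hc, hcomb W hW, Finset.sum_ite_eq', Finset.mem_univ, if_true] at hsum
    exact hsum

variable (K s n) in
/-- The family formed by `∑ i, β i 0`, by the sums `∑ i, γ i j`, and by the maps
`β (s-1) (j+1) + γ (s-1) j`. -/
def betaGamma : Unit ⊕ (Fin (n + 1 + 1) ⊕ Fin (n + 1)) → Cochain K s (n + 1) :=
  Sum.elim (fun _ => ∑ i : ZMod s, beta K s (n + 1) i 0)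
    (Sum.elim (fun j => ∑ i : ZMod s, gamma K s (n + 1) i j)
      (fun j => beta K s (n + 1) ((s - 1 : ℕ) : ZMod s) j.succ +
        gamma K s (n + 1) ((s - 1 : ℕ) : ZMod s) j.castSucc))

section betaGamma

variable (hn : (n : ZMod s) = 0) (i : ZMod s) (j : ℤ)

include hn

theorem coordX_betaGamma_inl (t : Unit) :
    coordX K s (n + 1) i j (betaGamma K s n (.inl t)) = if j = 0 then 1 else 0 := by
  simp only [betaGamma, Sum.elim_inl, map_sum, coordX_beta (cast_succ_eq_one hn), ite_and,
    Finset.sum_ite_eq, Finset.mem_univ, if_true, Fin.val_zero, Nat.cast_zero]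

theorem coordY_betaGamma_inl (t : Unit) :
    coordY K s (n + 1) i j (betaGamma K s n (.inl t)) = 0 := by
  simp only [betaGamma, Sum.elim_inl, map_sum, coordY_beta (cast_succ_eq_one hn),
    Finset.sum_const_zero]

theorem coordX_betaGamma_inr_inl (t : Fin (n + 1 + 1)) :
    coordX K s (n + 1) i j (betaGamma K s n (.inr (.inl t))) = 0 := by
  simp only [betaGamma, Sum.elim_inr, Sum.elim_inl, map_sum, coordX_gamma (cast_succ_eq_one hn),
    Finset.sum_const_zero]

theorem coordY_betaGamma_inr_inl (t : Fin (n + 1 + 1)) :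
    coordY K s (n + 1) i j (betaGamma K s n (.inr (.inl t))) = if j = (t : ℕ) then 1 else 0 := by
  simp only [betaGamma, Sum.elim_inr, Sum.elim_inl, map_sum, coordY_gamma (cast_succ_eq_one hn),
    ite_and, Finset.sum_ite_eq, Finset.mem_univ, if_true]

theorem coordX_betaGamma_inr_inr (t : Fin (n + 1)) :
    coordX K s (n + 1) i j (betaGamma K s n (.inr (.inr t))) =
      if i = -1 then if j - 1 = (t : ℕ) then 1 else 0 else 0 := by
  simp only [betaGamma, Sum.elim_inr, map_add, coordX_beta (cast_succ_eq_one hn),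
    coordX_gamma (cast_succ_eq_one hn), add_zero, natCast_sub_one, ite_and, Fin.val_succ,
    Nat.cast_succ, sub_eq_iff_eq_add]

theorem coordY_betaGamma_inr_inr (t : Fin (n + 1)) :
    coordY K s (n + 1) i j (betaGamma K s n (.inr (.inr t))) =
      if i = -1 then if j = (t : ℕ) then 1 else 0 else 0 := by
  simp only [betaGamma, Sum.elim_inr, map_add, coordY_beta (cast_succ_eq_one hn),
    coordY_gamma (cast_succ_eq_one hn), zero_add, natCast_sub_one, ite_and, Fin.val_castSucc]

variable (u : K) {V W : ℤ → K} (hV : ∀ l : ℤ, ¬(0 ≤ l ∧ l < (n + 1 + 1 : ℕ)) → V l = 0)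
  (hW : ∀ l : ℤ, ¬(0 ≤ l ∧ l < (n + 1 : ℕ)) → W l = 0)

include hW in
theorem coordX_sum_smul_betaGamma :
    coordX K s (n + 1) i j (∑ t, Sum.elim (fun _ : Unit => u) (Sum.elim
      (fun t : Fin (n + 1 + 1) => V (t : ℕ)) fun t : Fin (n + 1) => W (t : ℕ)) t •
        betaGamma K s n t) = (if j = 0 then u else 0) + if i = -1 then W (j - 1) else 0 := by
  simp only [map_sum, map_add, map_smul, Fintype.sum_sum_type, Sum.elim_inl, Sum.elim_inr,
    coordX_betaGamma_inl hn, coordX_betaGamma_inr_inl hn, coordX_betaGamma_inr_inr hn, smul_eq_mul,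
    mul_zero, Finset.sum_const_zero, zero_add, Finset.univ_unique, Finset.sum_singleton, mul_ite,
    mul_one]
  congr 1
  split_ifs
  · rw [← sum_fin_mul_ite W hW (j - 1)]
    simp only [mul_ite, mul_one, mul_zero]
  · exact Finset.sum_const_zero

include hV hW in
theorem coordY_sum_smul_betaGamma :
    coordY K s (n + 1) i j (∑ t, Sum.elim (fun _ : Unit => u) (Sum.elim
      (fun t : Fin (n + 1 + 1) => V (t : ℕ)) fun t : Fin (n + 1) => W (t : ℕ)) t •
        betaGamma K s n t) = V j + if i = -1 then W j else 0 := by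
  simp only [map_sum, map_add, map_smul, Fintype.sum_sum_type, Sum.elim_inl, Sum.elim_inr,
    coordY_betaGamma_inl hn, coordY_betaGamma_inr_inl hn, coordY_betaGamma_inr_inr hn, smul_eq_mul,
    mul_zero, Finset.sum_const_zero, zero_add, sum_fin_mul_ite V hV]
  congr 1
  split_ifs
  · exact sum_fin_mul_ite W hW j
  · simp only [mul_zero, Finset.sum_const_zero]

end betaGamma

/-- The classes of the family `betaGamma` form a basis. -/
theorem classesFormBasis_betaGamma (h : QuasiIso (QAug K s)) (hs : 3 ≤ s) (hn : (n : ZMod s) = 0)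
    (hε : (-1 : K) ^ n = 1) :
    ClassesFormBasis K (QResolution K s h) (n + 1) (betaGamma K s n) := by
  have hn1 := cast_succ_eq_one hn
  have hneg : (0 : ZMod s) ≠ -1 := (neg_ne_zero.2 (zmod_one_ne_zero hs)).symm
  have hcobX : ∀ (g : Cochain K s n) i j, coordX K s (n + 1) i j (cobd K s g) =
      coordE K s n i (j - 1) g - coordE K s n (i + 1) (j - 1) g := by
    intro g i j
    rw [coordX_cobd hs hn, pow_succ, hε]
    ring
  have hcobY : ∀ (g : Cochain K s n) i j, coordY K s (n + 1) i j (cobd K s g) =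
      coordE K s n i j g - coordE K s n (i + 1) j g := by
    intro g i j
    rw [coordY_cobd hs hn, pow_succ, hε]
    ring
  have hcob : ∀ (g : Cochain K s (n + 1)) i j, coordXY K s (n + 1 + 1) i j (cobd K s g) =
      (coordX K s (n + 1) i j g - coordY K s (n + 1) i (j - 1) g) -
        (coordX K s (n + 1) (i + 1) j g - coordY K s (n + 1) (i + 1) (j - 1) g) := by
    intro g i j
    rw [coordXY_cobd hs hn1, pow_succ, pow_succ, hε]
    ring
  refine classesFormBasis_succ h _ (fun t => ?_) (fun g hg => ?_) (fun c g' hc => ?_)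
  · refine cochain_ext_two hs (cast_succ_succ_eq_two hn) fun i j => ?_
    rw [hcob, map_zero]
    rcases t with t | t | t
    · simp only [coordX_betaGamma_inl hn, coordY_betaGamma_inl hn, sub_self]
    · simp only [coordX_betaGamma_inr_inl hn, coordY_betaGamma_inr_inl hn, sub_self]
    · simp only [coordX_betaGamma_inr_inr hn, coordY_betaGamma_inr_inr hn, sub_self]
  · -- `r j` is the common value of `p i j - q i (j - 1)` for the coordinates `p` and `q` of `g`
    have hr : ∀ i j, coordX K s (n + 1) i j g - coordY K s (n + 1) i (j - 1) g =
        coordX K s (n + 1) 0 j g - coordY K s (n + 1) 0 (j - 1) g := by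
      intro i j
      refine eq_of_forall_eq_add_one
        (c := fun i => coordX K s (n + 1) i j g - coordY K s (n + 1) i (j - 1) g) (fun i => ?_) i 0
      have hc := hcob g i j
      rw [hg, map_zero] at hc
      exact sub_eq_zero.1 hc.symm
    obtain ⟨r, hr'⟩ : ∃ r : ℤ → K, ∀ i j,
        coordX K s (n + 1) i j g - coordY K s (n + 1) i (j - 1) g = r j := ⟨_, hr⟩
    have hr0 : ∀ j : ℤ, ¬(0 ≤ j ∧ j ≤ (n + 1 + 1 : ℕ)) → r j = 0 := fun j hj => by
      rw [← hr' 0 j, coordX_of_not (by push_cast at *; omega),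
        coordY_of_not (by push_cast at *; omega), sub_zero]
    -- once the cocycle has been corrected so that `r = 0`, it is determined by its coordinates
    -- `p i (j + 1)`, which form a coboundary up to their sums over `i`
    choose c hc using fun j => exists_sub_add_one fun i => coordX K s (n + 1) i (j + 1) g
    obtain ⟨g', hg'⟩ := exists_coordE_eq hn fun i j => c j i
    -- the index `-1` is excluded, since `β i 0` has no partner among the `γ`
    obtain ⟨W, hWl⟩ : ∃ W : ℤ → K, ∀ l, W l =
        if l = -1 then 0 else ∑ i, coordX K s (n + 1) i (l + 1) g := ⟨_, fun _ => rfl⟩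
    obtain ⟨V, hVl⟩ : ∃ V : ℤ → K, ∀ l, V l = if l = -1 then 0 else -r (l + 1) :=
      ⟨_, fun _ => rfl⟩
    have hW : ∀ l : ℤ, ¬(0 ≤ l ∧ l < (n + 1 : ℕ)) → W l = 0 := fun l hl => by
      rw [hWl]
      split_ifs
      · rfl
      · exact Finset.sum_eq_zero fun i _ => coordX_of_not (by push_cast at *; omega) g
    have hV : ∀ l : ℤ, ¬(0 ≤ l ∧ l < (n + 1 + 1 : ℕ)) → V l = 0 := fun l hl => by
      rw [hVl]
      split_ifs
      · rfl
      · rw [hr0 (l + 1) (by push_cast at *; omega), neg_zero]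
    have hd : ∀ i j, coordE K s n i j g' - coordE K s n (i + 1) j g' =
        if j = -1 then 0 else coordX K s (n + 1) i (j + 1) g -
          if i = -1 then ∑ k, coordX K s (n + 1) k (j + 1) g else 0 := by
      intro i j
      by_cases hj : 0 ≤ j ∧ j ≤ n
      · rw [hg' _ _ hj, hg' _ _ hj, hc, if_neg (show ¬j = -1 by omega)]
      · rw [coordE_of_not hj, coordE_of_not hj, sub_self]
        split_ifs with h1 h2
        · rfl
        · rw [coordX_of_not (by push_cast; omega), Finset.sum_eq_zero, sub_zero]
          exact fun k _ => coordX_of_not (by push_cast; omega) g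
        · rw [coordX_of_not (by push_cast; omega), sub_zero]
    refine ⟨Sum.elim (fun _ => r 0) (Sum.elim (fun t => V (t : ℕ)) fun t => W (t : ℕ)), g',
      cochain_ext_one hs hn1 (fun i j => ?_) fun i j => ?_⟩
    · rw [map_add, coordX_sum_smul_betaGamma hn i j (r 0) hW, hcobX, hd, hWl, sub_add_cancel]
      by_cases hj : j = 0
      · have h0 := hr' i j
        rw [coordY_of_not (by omega), sub_zero, hj] at h0
        rw [if_pos (show j - 1 = -1 by omega), if_pos hj, if_pos (show j - 1 = -1 by omega),
          ite_self, zero_add, add_zero, hj, h0]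
      · rw [if_neg (show ¬j - 1 = -1 by omega), if_neg hj, if_neg (show ¬j - 1 = -1 by omega),
          zero_add, sub_add_cancel]
    · rw [map_add, coordY_sum_smul_betaGamma hn i j (r 0) hV hW, hcobY, hd, hWl, hVl]
      by_cases hj : j = -1
      · rw [if_pos hj, if_pos hj, if_pos hj, ite_self, coordY_of_not (by omega), add_zero, add_zero]
      · have h1 := hr' i (j + 1)
        rw [add_sub_cancel_right] at h1
        rw [if_neg hj, if_neg hj, if_neg hj]
        linear_combination -h1
  · obtain ⟨V, hV, hV'⟩ := exists_int_extension fun t => c (.inr (.inl t))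
    obtain ⟨W, hW, hW'⟩ := exists_int_extension fun t => c (.inr (.inr t))
    have hcc : c = Sum.elim (fun _ => c (.inl ())) (Sum.elim
        (fun t : Fin (n + 1 + 1) => V (t : ℕ)) fun t : Fin (n + 1) => W (t : ℕ)) := by
      funext t
      rcases t with t | t | t
      · rfl
      · exact congrFun hV' t
      · exact congrFun hW' t
    generalize c (.inl ()) = u at hcc
    subst hcc
    have hX : ∀ i j, _ := fun i j =>
      (hcobX g' i j).symm.trans ((congrArg (coordX K s (n + 1) i j) hc).trans
        (coordX_sum_smul_betaGamma hn i j u hW))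
    have hY : ∀ i j, _ := fun i j =>
      (hcobY g' i j).symm.trans ((congrArg (coordY K s (n + 1) i j) hc).trans
        (coordY_sum_smul_betaGamma hn i j u hV hW))
    have hu : u = 0 := by
      have h0 := hX 0 0
      rw [coordE_of_not (by omega), coordE_of_not (by omega), if_pos rfl, if_neg hneg] at h0
      linear_combination -h0
    have hVz : ∀ j, 0 ≤ j → V j = 0 := by
      intro j hj
      have h1 := hX 0 (j + 1)
      have h2 := hY 0 j
      rw [add_sub_cancel_right, if_neg (by omega), if_neg hneg] at h1
      rw [if_neg hneg] at h2
      linear_combination h1 - h2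
    have hWz : ∀ j, 0 ≤ j → W j = 0 := by
      intro j hj
      have hsum := sum_sub_add_one fun i => coordE K s n i j g'
      simp only [hY, hVz j hj, zero_add, Finset.sum_ite_eq', Finset.mem_univ, if_true] at hsum
      exact hsum
    funext t
    rcases t with t | t | t
    · exact hu
    · exact hVz _ (Int.natCast_nonneg _)
    · exact hWz _ (Int.natCast_nonneg _)

end CircAlg

end

open CircAlg in
theorem proposition3p8 {K : Type u} [Field K] [IsAlgClosed K] (s : ℕ) [NeZero s] (hs : 3 ≤ s) :
    -- the explicit complex of projective bimodules is a resolution of the algebra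
    ∃ h : QuasiIso (QAug K s), ∀ m : ℕ,
      -- vanishing in the degrees `m s`, `m s + 1`, `m s + 2`
      (Odd s ∧ Odd m ∧ ringChar K ≠ 2 →
        Subsingleton (HH K (Lam K s) (m * s)) ∧
        Subsingleton (HH K (Lam K s) (m * s + 1)) ∧
        Subsingleton (HH K (Lam K s) (m * s + 2))) ∧
      -- bases in the degrees `m s`, `m s + 1`, `m s + 2`
      (Even s ∨ Even m ∨ ringChar K = 2 →
        ClassesFormBasis K (QResolution K s h) (m * s)
          (fun j : Fin (m * s + 1) => ∑ i : ZMod s, alpha K s (m * s) i j) ∧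
        ClassesFormBasis K (QResolution K s h) (m * s + 1)
          (Sum.elim (fun _ : Unit => ∑ i : ZMod s, beta K s (m * s + 1) i 0)
            (Sum.elim
              (fun j : Fin (m * s + 2) => ∑ i : ZMod s, gamma K s (m * s + 1) i j)
              (fun j : Fin (m * s + 1) =>
                beta K s (m * s + 1) ((s - 1 : ℕ) : ZMod s) j.succ +
                  gamma K s (m * s + 1) ((s - 1 : ℕ) : ZMod s) j.castSucc))) ∧
        ClassesFormBasis K (QResolution K s h) (m * s + 2)
          (fun j : Fin (m * s + 3) => delta K s (m * s + 2) ((s - 1 : ℕ) : ZMod s) j)) ∧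
      -- vanishing in all other degrees
      (∀ r : ℕ, r < s → r ≠ 0 → r ≠ 1 → r ≠ 2 →
        Subsingleton (HH K (Lam K s) (m * s + r))) := by
  refine ⟨quasiIso_QAug K s, fun m => ?_⟩
  have hn : ((m * s : ℕ) : ZMod s) = 0 := by rw [Nat.cast_mul, ZMod.natCast_self, mul_zero]
  refine ⟨?_, ?_, ?_⟩
  · rintro ⟨hodd, hm, hchar⟩
    have h2 : (2 : K) ≠ 0 := Ring.two_ne_zero hchar
    have hε : (-1 : K) ^ (m * s) = -1 := (hm.mul hodd).neg_one_pow
    exact ⟨subsingleton_HH_of_odd (quasiIso_QAug K s) hs hn hodd h2 hε,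
      subsingleton_HH_succ_of_odd (quasiIso_QAug K s) hs hn hodd h2 hε,
      subsingleton_HH_succ_succ_of_odd (quasiIso_QAug K s) hs hn hodd h2 hε⟩
  · intro hcase
    have hε : (-1 : K) ^ (m * s) = 1 := by
      rcases hcase with h | h | h
      · exact (h.mul_left m).neg_one_pow
      · exact (h.mul_right s).neg_one_pow
      · have : CharP K 2 := h ▸ ringChar.charP K
        rw [CharTwo.neg_eq, one_pow]
    exact ⟨classesFormBasis_sumAlpha _ hs hn hε, classesFormBasis_betaGamma _ hs hn hε,
      classesFormBasis_delta _ hs hn hε⟩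
  · intro r hr h0 h1 h2
    have hcast : ((m * s + r : ℕ) : ZMod s) = (r : ZMod s) := by rw [Nat.cast_add, hn, zero_add]
    have key : ∀ k : ℕ, k < s → r ≠ k → ((m * s + r : ℕ) : ZMod s) ≠ (k : ZMod s) := by
      intro k hk hrk h
      rw [hcast, ZMod.natCast_eq_natCast_iff'] at h
      rw [Nat.mod_eq_of_lt hr, Nat.mod_eq_of_lt hk] at h
      exact hrk h
    exact subsingleton_HH_of_cast_ne (quasiIso_QAug K s)
      (by simpa using key 0 (by omega) h0) (by simpa using key 1 (by omega) h1)
      (by simpa using key 2 (by omega) h2)
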